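/- **Setting.** A school matching instance $I=(A,B,\succ,q)$ has finite sets $A$ (students) and $B$ (schools), for every $a\in A$ a strict total order $\succ_a$ on $B\cup\{\emptyset\}$, for every $b\in B$ a strict total order $\succ_b$ on $A\cup\{\emptyset\}$, and quotas $q_b\le |A|$. A matching $M$ assigns each student a partner $M(a)\in B\cup\{\emptyset\}$ with at most $q_b$ students at each school $b$; $M(b)$ is the set of students at $b$, together with $\emptyset$ if there are fewer than $q_b$ of them. As a set of pairs, $M$ consists of all pairs $(a,M(a))$ with $a\in A$, and of the pairs $(\emptyset,b)$ with $b \in B$ and $\emptyset\in M(b)$. It is stable if there is no pair $ab \in A\times B$ with $b\succ_a M(a)$ and $a\succ_b a'$ for some $a'\in M(b)$, no student $a$ with $\emptyset\succ_a M(a)$, and no school $b$ with $\emptyset\succ_b a'$ for some $a'\in M(b)$. The set $\mathcal S(I)$ of stable matchings is a lattice for the order $M\ge M'$ iff $M(a)\succeq_a M'(a)$ for all $a\in A$; its greatest element is $M_0$. A rotation is a pair $\rho(M,M')=(M\setminus M',M'\setminus M)$, where $M,M'\in\mathcal S(I)$, $M'<M$, and no stable matching lies strictly between; $\mathcal R(I)$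 is the set of rotations. Such a rotation is said to be exposed in $M$. If $M_0,M_1,\dots,M_k=M$ is a sequence of stable matchings in which each is an immediate predecessor of the one before, the set $R_M=\{\rho(M_{i-1},M_i): 1\le i\le k\}$ depends only on $M$ and determines $M$; write $M=M_R$ if $R=R_M$. For rotations, $\rho\trianglerighteq\rho'$ means that $\rho=\rho'$ or that $\rho\in R_M$ for every $M \in \mathcal S(I)$ in which $\rho'$ is exposed. A set of rotations is upper-closed if it contains every $\rho'\trianglerighteq\rho$ whenever it contains $\rho$; every upper-closed $R$ equals $R_M$ for a stable matching $M$. Let $\mathcal F\subseteq\mathcal S(I)$ and $f:\mathcal F\to\mathbb R$, and let $\Pi(f,\mathcal F)$ be the problem $\min_{M\in\mathcal F}f(M)$. It is *minimum cut representable* if there are a digraph on $\mathcal R(I)\cup\{s,t\}$ with arc capacities in $[0,\infty]$ and a real $C$ such that, for every $R\subseteq\mathcal R(I)$, the $s$-$t$ cut $\{s\}\cup R$ has finite capacity if and only if $R$ is upper-closed and $M_R\in\mathcal F$, and in that case its capacity is $f(M_R)+C$. It is *an instance of minimum weight stable matching (MWSM)* if $\mathcal F$ is a sublattice of $\mathcal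 S(I)$ and there are weights $w_{ab}\in\mathbb R$ ($a\in A$, $b\in B$) with $f(M)=\sum_{ab\in M,\ a \in A,\ b \in B}w_{ab}$ for every $M\in\mathcal F$. Call $\rho,\rho'\in\mathcal R(I)$ equivalent if $\rho\in R_M\Leftrightarrow\rho'\in R_M$ for all $M\in\mathcal F$. The proper meta-rotations are the equivalence classes other than $\theta_0=\{\rho:\rho\in R_M\ \forall M\in\mathcal F\}$ and $\theta_z=\{\rho:\rho\notin R_M\ \forall M\in\mathcal F\}$. For proper meta-rotations, $\theta\trianglerighteq\theta'$ means that every $M\in\mathcal F$ with $\theta'\subseteq R_M$ satisfies $\theta\subseteq R_M$. Let $M^\theta$ (resp. $M_\theta$) be the stable matching whose set of rotations is the union of $\theta_0$ and all proper $\theta'\trianglerighteq\theta$ (resp. all proper $\theta'\trianglerighteq\theta$ with $\theta'\ne\theta$). For distinct proper meta-rotations $\theta,\theta'$ put $$\partial^2 f_{\theta,\theta'}=f(M^\theta\wedge M_{\theta'})+f(M_\theta\wedge M^{\theta'})-f(M_\theta\wedge M_{\theta'})-f(M^\theta\wedge M^{\theta'});$$ all these matchings exist, and the four meets lie in $\mathcal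 F$, whenever $\mathcal F$ is a sublattice, in particular whenever $\Pi(f,\mathcal F)$ is minimum cut representable. **Theorem.** Suppose that some stable matching of $I$ matches some student to a school. Let $\mathcal F\subseteq\mathcal S(I)$ and $f:\mathcal F\to\mathbb R$. Then $\Pi(f,\mathcal F)$ is an instance of (MWSM) if and only if it is minimum cut representable and $\partial^2 f_{\theta,\theta'}=0$ for all distinct proper meta-rotations $\theta\ne\theta'$. -/

import Mathlib

namespace StableMatchingOpt

/-- A school matching instance `(A, B, ≻, q)`: students `A`, schools `B`; every student has a strict
total order on `B⁺ = B ∪ {∅}`, every school a strict total order on `A⁺ = A ∪ {∅}` (the outside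
option `∅` is `none`), and every school has a quota `q b ≤ |A|`.
`stuPref a x y` means `x ≻_a y`, and `schPref b x y` means `x ≻_b y`. -/
structure SchoolInstance (A B : Type*) [Fintype A] [Fintype B] where
  stuPref : A → Option B → Option B → Prop
  schPref : B → Option A → Option A → Prop
  quota : B → ℕ
  stuPref_strict : ∀ a, IsStrictTotalOrder (Option B) (stuPref a)
  schPref_strict : ∀ b, IsStrictTotalOrder (Option A) (schPref b)
  quota_le : ∀ b, quota b ≤ Fintype.card A

variable {A B : Type*} [Fintype A] [Fintype B]

/-- A matching: every student has a unique partner in `B⁺`, and no quota is exceeded. -/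
structure Matching (I : SchoolInstance A B) where
  partner : A → Option B
  card_le : ∀ b, {a | partner a = some b}.ncard ≤ I.quota b

namespace Matching

variable {I : SchoolInstance A B}

/-- The partners `M(b) ⊆ A⁺` of a school: its students, together with the outside option exactly
when the quota is not filled. -/
def schoolPartners (M : Matching I) (b : B) : Set (Option A) :=
  {x | (∃ a, x = some a ∧ M.partner a = some b) ∨
    (x = none ∧ {a | M.partner a = some b}.ncard < I.quota b)}

/-- The matching as a set of pairs `M ⊆ A⁺ × B⁺`. -/
def pairs (M : Matching I) : Set (Option A × Option B) :=
  {p | (∃ a, p = (some a, M.partner a)) ∨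
    (∃ b, p = (none, some b) ∧ none ∈ M.schoolPartners b)}

/-- `M` has no blocking pair, no blocking student and no blocking school. -/
def IsStable (M : Matching I) : Prop :=
  (¬ ∃ a b, I.stuPref a (some b) (M.partner a) ∧
      ∃ a' ∈ M.schoolPartners b, I.schPref b (some a) a') ∧
  (¬ ∃ a, I.stuPref a none (M.partner a)) ∧
  (¬ ∃ b, ∃ a' ∈ M.schoolPartners b, I.schPref b none a')

end Matching

/-- The set `S(I)` of stable matchings of the instance `I`. -/
structure StableMatching (I : SchoolInstance A B) where
  toMatching : Matching I
  stable : toMatching.IsStable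

variable {I : SchoolInstance A B}

theorem StableMatching.ext_partner {M N : StableMatching I}
    (h : M.toMatching.partner = N.toMatching.partner) : M = N := by
  obtain ⟨⟨p, hp⟩, hM⟩ := M
  obtain ⟨⟨q, hq⟩, hN⟩ := N
  cases h
  rfl

/-- `M ≥ M'` if and only if `M(a) ⪰_a M'(a)` for every student `a`. -/
instance : PartialOrder (StableMatching I) where
  le M' M := ∀ a, M.toMatching.partner a = M'.toMatching.partner a ∨
    I.stuPref a (M.toMatching.partner a) (M'.toMatching.partner a)
  le_refl _ _ := Or.inl rfl
  le_trans M N P h1 h2 a := by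
    have := I.stuPref_strict a
    rcases h1 a with e1 | e1 <;> rcases h2 a with e2 | e2
    · exact Or.inl (e2.trans e1)
    · exact Or.inr (e1 ▸ e2)
    · exact Or.inr (e2 ▸ e1)
    · exact Or.inr (_root_.trans e2 e1)
  le_antisymm M N h1 h2 := by
    apply StableMatching.ext_partner
    funext a
    have := I.stuPref_strict a
    rcases h1 a with e1 | e1
    · exact e1.symm
    · rcases h2 a with e2 | e2
      · exact e2
      · exact absurd e2 (asymm e1)

/-- `F` is a sublattice of `(S(I), ≥)`: it contains the join and the meet of any two of its
members (joins and meets are taken in `S(I)`). -/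
def IsSublattice (F : Set (StableMatching I)) : Prop :=
  ∀ M ∈ F, ∀ N ∈ F, (∃ J ∈ F, IsLUB {M, N} J) ∧ (∃ K ∈ F, IsGLB {M, N} K)

/-- The pair `ρ(M, M') = (M \ M', M' \ M)`. -/
def rotationPair (M M' : StableMatching I) :
    Set (Option A × Option B) × Set (Option A × Option B) :=
  (M.toMatching.pairs \ M'.toMatching.pairs, M'.toMatching.pairs \ M.toMatching.pairs)

/-- The set `R(I)` of rotations: all `ρ(M, M')` with `M'` an immediate predecessor of `M`
(`M' ⋖ M`: `M' < M` and no stable matching lies strictly between). -/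
def Rotation (I : SchoolInstance A B) : Type _ :=
  {ρ : Set (Option A × Option B) × Set (Option A × Option B) //
    ∃ M M' : StableMatching I, M' ⋖ M ∧ ρ = rotationPair M M'}

noncomputable instance : Fintype (Rotation I) :=
  have : Finite (Rotation I) := Subtype.finite
  Fintype.ofFinite _

/-- `ρ` is exposed in `M`. -/
def Exposed (ρ : Rotation I) (M : StableMatching I) : Prop :=
  ∃ M' : StableMatching I, M' ⋖ M ∧ ρ.1 = rotationPair M M'

/-- `M = M₀ / R`: there are stable matchings `s 0, …, s k` from the student-optimal one `s 0 = M₀`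
to `s k = M`, each an immediate predecessor of the one before, and `R` is the set of the rotations
eliminated on the way. -/
def IsElimination (R : Set (Rotation I)) (M : StableMatching I) : Prop :=
  ∃ (k : ℕ) (s : ℕ → StableMatching I), (∀ N, N ≤ s 0) ∧ s k = M ∧
    (∀ i < k, s (i + 1) ⋖ s i) ∧
    R = {ρ | ∃ i < k, ρ.1 = rotationPair (s i) (s (i + 1))}

/-- `R_M`: the rotations eliminated on the way from `M₀` to `M` (the set `R` with `M = M₀ / R`). -/
def rotationsOf (M : StableMatching I) : Set (Rotation I) :=
  {ρ | ∃ R, IsElimination R M ∧ ρ ∈ R}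

/-- The order `ρ ⊵ ρ'` of the poset of rotations. -/
def RotGE (ρ ρ' : Rotation I) : Prop :=
  ρ = ρ' ∨ ∀ M : StableMatching I, Exposed ρ' M → ∀ R, IsElimination R M → ρ ∈ R

/-- Upper-closed sets of rotations. -/
def IsUpperClosed (R : Set (Rotation I)) : Prop :=
  ∀ ρ ∈ R, ∀ ρ', RotGE ρ' ρ → ρ' ∈ R

/-! Minimum cut representability. -/

/-- The vertices of a witness digraph: the rotations, the source and the sink. -/
abbrev Vertex (I : SchoolInstance A B) : Type _ := Rotation I ⊕ Bool

/-- The source vertex `s` (the sink `t` is `Sum.inr true`). -/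
abbrev source (I : SchoolInstance A B) : Vertex I := Sum.inr false

/-- The side `{s} ∪ R` of an `s`-`t` cut. -/
def cutSide (R : Set (Rotation I)) : Set (Vertex I) :=
  insert (source I) (Sum.inl '' R)

open Classical in
/-- The capacity of the `s`-`t` cut `{s} ∪ R`: the sum of the capacities of the arcs that leave
`{s} ∪ R`. A capacitated digraph is its capacity function (capacity `0` where there is no arc). -/
noncomputable def cutValue (u : Vertex I → Vertex I → ENNReal) (R : Set (Rotation I)) : ENNReal :=
  ∑ v : Vertex I, ∑ w : Vertex I, if v ∈ cutSide R ∧ w ∉ cutSide R then u v w else 0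

/-- The problem `min {f M : M ∈ F}` is minimum cut representable. -/
def MinCutRepresentable (F : Set (StableMatching I)) (f : F → ℝ) : Prop :=
  ∃ (u : Vertex I → Vertex I → ENNReal) (C : ℝ),
    (∀ R : Set (Rotation I),
      cutValue u R < ⊤ ↔ IsUpperClosed R ∧ ∃ M ∈ F, IsElimination R M) ∧
    (∀ R : Set (Rotation I), cutValue u R < ⊤ →
      ∀ M : F, IsElimination R M.1 → (cutValue u R).toReal = f M + C)

/-! Meta-rotations and differentials. -/

/-- `ρ ∼ ρ'`: the two rotations are always eliminated together in the matchings of `F`. -/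
def MetaEquiv (F : Set (StableMatching I)) (ρ ρ' : Rotation I) : Prop :=
  ∀ M ∈ F, (ρ ∈ rotationsOf M ↔ ρ' ∈ rotationsOf M)

/-- The trivial meta-rotation `θ₀`: the rotations eliminated in every matching of `F`. -/
def theta0 (F : Set (StableMatching I)) : Set (Rotation I) :=
  {ρ | ∀ M ∈ F, ρ ∈ rotationsOf M}

/-- The trivial meta-rotation `θ_z`: the rotations eliminated in no matching of `F`. -/
def thetaZ (F : Set (StableMatching I)) : Set (Rotation I) :=
  {ρ | ∀ M ∈ F, ρ ∉ rotationsOf M}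

/-- The proper meta-rotations: the equivalence classes of `∼` other than `θ₀` and `θ_z`. -/
def ProperMeta (F : Set (StableMatching I)) : Type _ :=
  {θ : Set (Rotation I) // (∃ ρ, θ = {ρ' | MetaEquiv F ρ ρ'}) ∧ θ ≠ theta0 F ∧ θ ≠ thetaZ F}

/-- The order `θ ⊵ θ'` on proper meta-rotations. -/
def MetaGE {F : Set (StableMatching I)} (θ θ' : ProperMeta F) : Prop :=
  ∀ M ∈ F, θ'.1 ⊆ rotationsOf M → θ.1 ⊆ rotationsOf M

/-- `M = M_Θ`: the stable matching obtained from `M₀` by eliminating `θ₀` and all the rotations of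
the meta-rotations in `Θ`. -/
def IsMatchingOf {F : Set (StableMatching I)} (Θ : Set (ProperMeta F)) (M : StableMatching I) :
    Prop :=
  IsElimination (theta0 F ∪ ⋃ θ ∈ Θ, θ.1) M

/-- `Θ^θ`: the proper meta-rotations `θ' ⊵ θ`. -/
def metaUp {F : Set (StableMatching I)} (θ : ProperMeta F) : Set (ProperMeta F) :=
  {θ' | MetaGE θ' θ}

/-- `Θ_θ`: the proper meta-rotations `θ' ▷ θ`. -/
def metaStrictUp {F : Set (StableMatching I)} (θ : ProperMeta F) : Set (ProperMeta F) :=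
  {θ' | MetaGE θ' θ ∧ θ' ≠ θ}

/-- The second order differential of `f` at `(θ, θ')` exists and equals `d`, where
`∂²f_{θ,θ'} = f(M^θ ∧ M_θ') + f(M_θ ∧ M^θ') - f(M_θ ∧ M_θ') - f(M^θ ∧ M^θ')`.
Here `Mu, Ml, Mu', Ml'` are `M^θ, M_θ, M^θ', M_θ'`, and `P, Q, R, S` are the four meets. -/
def HasSecondDifferential {F : Set (StableMatching I)} (f : F → ℝ) (θ θ' : ProperMeta F) (d : ℝ) :
    Prop :=
  ∃ Mu Ml Mu' Ml' : StableMatching I,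
    IsMatchingOf (metaUp θ) Mu ∧ IsMatchingOf (metaStrictUp θ) Ml ∧
    IsMatchingOf (metaUp θ') Mu' ∧ IsMatchingOf (metaStrictUp θ') Ml' ∧
    ∃ P Q R S : F,
      IsGLB {Mu, Ml'} P.1 ∧ IsGLB {Ml, Mu'} Q.1 ∧ IsGLB {Ml, Ml'} R.1 ∧ IsGLB {Mu, Mu'} S.1 ∧
      d = f P + f Q - f R - f S

open Classical in
/-- `f` is linear in the matched pairs: for some weights `w a b` of the pairs `ab ∈ A × B`, the
value of every `M ∈ F` is the sum of the weights of the pairs `ab ∈ M`. -/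
def IsLinearObjective (F : Set (StableMatching I)) (f : F → ℝ) : Prop :=
  ∃ w : A → B → ℝ, ∀ M : F,
    f M = ∑ a, ∑ b, if M.1.toMatching.partner a = some b then w a b else 0

/-- The problem `min {f M : M ∈ F}` is an instance of minimum weight stable matching: `F` is a
sublattice of the lattice of stable matchings and the objective is linear in the matched pairs. -/
def IsMWSM (F : Set (StableMatching I)) (f : F → ℝ) : Prop :=
  IsSublattice F ∧ IsLinearObjective F f

end StableMatchingOpt

namespace StableMatchingOpt

/-! ### Numerical ranks -/

/-! The rotation sets of stable matchings turn the lattice into a ring of sets. A student who moves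
in an immediate descent cannot be separated from the other movers by any stable matching
(`rank_le_or_le_rank_of_covBy`), so whether a rotation has been eliminated is a threshold condition
on the rank of the partner of a single student (`exists_rank_threshold`). Hence meets become unions,
joins become intersections, and the indicator of each rotation is itself linear in the matched
pairs.

From (MWSM) to cuts: a rotation always changes the total weight by the same amount, so a linear
objective is a constant plus a sum of rotation weights (`exists_rotation_weights`). Birkhoff's
description of a ring of sets (`mem_iff_of_supClosed_of_infClosed`) says which arcs must have
infinite capacity, and arcs at the source and the sink carry the weights. The matchings in a second
differential form a modular square, on which such an objective has difference zero.

From cuts to (MWSM): finite cuts are closed under union and intersection, so F is a sublattice. The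
objective is a sum of arc contributions. An arc from one rotation to another contributes zero if the
first forces the second, and a difference of two indicators if only the second forces the first. If
neither forces the other, a vanishing second differential makes submodularity tight on a pair of
sets that the arc crosses, so its capacity is zero (`capacity_eq_zero_of_incomparable`). What
remains is a combination of indicators and constants. Constants are linear because a student matched
in one stable matching is matched in all. -/

/-- The number of elements below `x` in the relation `r`. -/
noncomputable def strictRank {α : Type*} (r : α → α → Prop) (x : α) : ℕ := {y | r x y}.ncard

/-- Replaces the preference orders by comparisons of natural numbers, so that joins and meets of
matchings become `max` and `min`. -/
theorem strictRank_lt_iff {α : Type*} [Finite α] {r : α → α → Prop} (h : IsStrictTotalOrder α r)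
    {x y : α} : r x y ↔ strictRank r y < strictRank r x := by
  have key : ∀ x y, r x y → strictRank r y < strictRank r x := by
    intro x y hxy
    apply Set.ncard_lt_ncard _ (Set.toFinite _)
    refine ⟨fun z hz => _root_.trans hxy hz, fun hs => ?_⟩
    exact irrefl y (hs (show r x y from hxy))
  refine ⟨key x y, fun hlt => ?_⟩
  rcases trichotomous_of r x y with h1 | h1 | h1
  · exact h1
  · subst h1; exact absurd hlt (lt_irrefl _)
  · exact absurd (key _ _ h1) (by omega)

theorem strictRank_injective {α : Type*} [Finite α] {r : α → α → Prop}
    (h : IsStrictTotalOrder α r) : Function.Injective (strictRank r) := by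
  intro x y hxy
  rcases trichotomous_of r x y with h1 | h1 | h1
  · have := (strictRank_lt_iff h).1 h1; omega
  · exact h1
  · have := (strictRank_lt_iff h).1 h1; omega

variable {A B : Type*} [Fintype A] [Fintype B] {I : SchoolInstance A B}

/-- The position of `x` in the preference list of the student `a` (larger is better). -/
noncomputable def stuRank (I : SchoolInstance A B) (a : A) (x : Option B) : ℕ :=
  strictRank (I.stuPref a) x

/-- The position of `x` in the preference list of the school `b` (larger is better). -/
noncomputable def schRank (I : SchoolInstance A B) (b : B) (x : Option A) : ℕ :=
  strictRank (I.schPref b) x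

theorem stuPref_iff {a : A} {x y : Option B} : I.stuPref a x y ↔ stuRank I a y < stuRank I a x :=
  strictRank_lt_iff (I.stuPref_strict a)

theorem schPref_iff {b : B} {x y : Option A} : I.schPref b x y ↔ schRank I b y < schRank I b x :=
  strictRank_lt_iff (I.schPref_strict b)

theorem stuRank_inj {a : A} {x y : Option B} : stuRank I a x = stuRank I a y ↔ x = y :=
  (strictRank_injective (I.stuPref_strict a)).eq_iff

theorem schRank_inj {b : B} {x y : Option A} : schRank I b x = schRank I b y ↔ x = y :=
  (strictRank_injective (I.schPref_strict b)).eq_iff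

/-! ### Consequences of stability in terms of ranks. -/

namespace StableMatching

/-- The rank that the student `a` gives to its partner. -/
noncomputable def rank (M : StableMatching I) (a : A) : ℕ := stuRank I a (M.toMatching.partner a)

/-- The students matched to the school `b`. -/
def students (M : StableMatching I) (b : B) : Set A := {a | M.toMatching.partner a = some b}

theorem mem_students {M : StableMatching I} {b : B} {a : A} :
    a ∈ M.students b ↔ M.toMatching.partner a = some b := Iff.rfl

theorem rank_eq_iff {M N : StableMatching I} {a : A} :
    M.rank a = N.rank a ↔ M.toMatching.partner a = N.toMatching.partner a := stuRank_inj

theorem le_iff_rank {M N : StableMatching I} : M ≤ N ↔ ∀ a, M.rank a ≤ N.rank a := by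
  refine forall_congr' fun a => ?_
  rw [← rank_eq_iff, stuPref_iff]
  change N.rank a = M.rank a ∨ M.rank a < N.rank a ↔ _
  omega

theorem rank_none_le (M : StableMatching I) (a : A) : stuRank I a none ≤ M.rank a := by
  have := M.stable.2.1
  push Not at this
  have := this a
  rw [stuPref_iff] at this
  exact not_lt.1 this

theorem card_students_le (M : StableMatching I) (b : B) : (M.students b).ncard ≤ I.quota b :=
  M.toMatching.card_le b

theorem schRank_none_lt (M : StableMatching I) {a : A} {b : B} (h : a ∈ M.students b) :
    schRank I b none < schRank I b (some a) := by
  have := M.stable.2.2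
  push Not at this
  have := this b (some a) (Or.inl ⟨a, rfl, h⟩)
  rw [schPref_iff, not_lt] at this
  refine lt_of_le_of_ne this fun he => ?_
  simpa using schRank_inj.1 he

theorem schRank_le_of_rank_lt (M : StableMatching I) {a : A} {b : B}
    (h : M.rank a < stuRank I a (some b)) {x : Option A}
    (hx : x ∈ M.toMatching.schoolPartners b) : schRank I b (some a) ≤ schRank I b x := by
  have := M.stable.1
  push Not at this
  have := this a b (stuPref_iff.2 h) x hx
  rwa [schPref_iff, not_lt] at this

/-- If `a` prefers its school `b` under `M` to its partner under `N`, then under `N` the school is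
full and all its students are better than `a`. -/
theorem full_of_rank_lt {M N : StableMatching I} {a : A} {b : B} (ha : a ∈ M.students b)
    (h : N.rank a < M.rank a) :
    (N.students b).ncard = I.quota b ∧
      ∀ a' ∈ N.students b, schRank I b (some a) < schRank I b (some a') := by
  have hr : M.rank a = stuRank I a (some b) := by rw [rank, mem_students.1 ha]
  rw [hr] at h
  constructor
  · by_contra hne
    have hlt : (N.students b).ncard < I.quota b := lt_of_le_of_ne (N.card_students_le b) hne
    have h1 := N.schRank_le_of_rank_lt h (x := none) (Or.inr ⟨rfl, hlt⟩)
    have h2 := M.schRank_none_lt ha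
    omega
  · intro a' ha'
    refine lt_of_le_of_ne (N.schRank_le_of_rank_lt h (Or.inl ⟨a', rfl, ha'⟩)) fun he => ?_
    have : a = a' := by simpa using schRank_inj.1 he
    subst this
    rw [rank, mem_students.1 ha'] at h
    exact lt_irrefl _ h

/-! ### Joins, meets, and the rural hospital theorem -/

open Classical in
/-- Every student takes the better of its two partners. -/
noncomputable def maxPartner (M N : StableMatching I) (a : A) : Option B :=
  if M.rank a ≤ N.rank a then N.toMatching.partner a else M.toMatching.partner a

open Classical in
/-- Every student takes the worse of its two partners. -/
noncomputable def minPartner (M N : StableMatching I) (a : A) : Option B :=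
  if M.rank a ≤ N.rank a then M.toMatching.partner a else N.toMatching.partner a

theorem maxPartner_comm (M N : StableMatching I) : maxPartner M N = maxPartner N M := by
  funext a
  unfold maxPartner
  split_ifs with h1 h2 h2
  · exact (rank_eq_iff.1 (le_antisymm h1 h2)).symm
  · rfl
  · rfl
  · omega

theorem minPartner_comm (M N : StableMatching I) : minPartner M N = minPartner N M := by
  funext a
  unfold minPartner
  split_ifs with h1 h2 h2
  · exact (rank_eq_iff.1 (le_antisymm h1 h2))
  · rfl
  · rfl
  · omega

theorem rank_maxPartner (M N : StableMatching I) (a : A) :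
    stuRank I a (maxPartner M N a) = max (M.rank a) (N.rank a) := by
  unfold maxPartner
  split_ifs with h
  · exact (max_eq_right h).symm
  · exact (max_eq_left (not_le.1 h).le).symm

theorem rank_minPartner (M N : StableMatching I) (a : A) :
    stuRank I a (minPartner M N a) = min (M.rank a) (N.rank a) := by
  unfold minPartner
  split_ifs with h
  · exact (min_eq_left h).symm
  · exact (min_eq_right (not_le.1 h).le).symm

/-- A school cannot have both a student of M who strictly prefers M and a student of N who strictly
prefers N: by `full_of_rank_lt` each would be strictly worse for the school than the other. If there
is a student of either kind, the opposite matching fills the school. -/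
theorem maxPartner_fiber (M N : StableMatching I) (b : B) :
    ({a | maxPartner M N a = some b} ⊆ M.students b ∨
        {a | maxPartner M N a = some b} ⊆ N.students b) ∧
      {a | maxPartner M N a = some b}.ncard ≤ (M.students b).ncard := by
  by_cases hX : ∃ a ∈ M.students b, N.rank a < M.rank a
  · obtain ⟨a, ha, hlt⟩ := hX
    obtain ⟨hq, hb⟩ := full_of_rank_lt ha hlt
    have hsub : {a | maxPartner M N a = some b} ⊆ M.students b := by
      intro a' ha'
      simp only [Set.mem_ofPred_eq, maxPartner] at ha'
      split_ifs at ha' with h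
      · rcases h.lt_or_eq with h | h
        · have h1 := (full_of_rank_lt ha' h).2 a ha
          have h2 := hb a' ha'
          omega
        · exact mem_students.2 ((rank_eq_iff.1 h).trans ha')
      · exact ha'
    exact ⟨Or.inl hsub, Set.ncard_le_ncard hsub (Set.toFinite _)⟩
  · push Not at hX
    have hsub : {a | maxPartner M N a = some b} ⊆ N.students b := by
      intro a' ha'
      simp only [Set.mem_ofPred_eq, maxPartner] at ha'
      split_ifs at ha' with h
      · exact ha'
      · exact absurd (hX a' ha') h
    refine ⟨Or.inr hsub, ?_⟩
    by_cases hY : ∃ a ∈ N.students b, M.rank a < N.rank a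
    · obtain ⟨a, ha, hlt⟩ := hY
      rw [(full_of_rank_lt ha hlt).1]
      exact (Set.ncard_le_ncard hsub (Set.toFinite _)).trans (N.card_students_le b)
    · push Not at hY
      refine Set.ncard_le_ncard (fun a ha => ?_) (Set.toFinite _)
      have h1 := hY a (hsub ha)
      simp only [Set.mem_ofPred_eq, maxPartner] at ha
      split_ifs at ha with h
      · exact mem_students.2 ((rank_eq_iff.1 (le_antisymm h h1)).trans ha)
      · exact ha

theorem sum_ncard_fiber (p : A → Option B) :
    ∑ b, {a | p a = some b}.ncard = {a | p a ≠ none}.ncard := by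
  have h : {a | p a ≠ none} = ⋃ b, {a | p a = some b} := by
    ext a
    simp [Option.ne_none_iff_exists']
  rw [h, Set.ncard_iUnion_of_finite (fun _ => Set.toFinite _), finsum_eq_sum_of_fintype]
  intro b b' hne
  rw [Function.onFun, Set.disjoint_left]
  intro a (ha : p a = some b) (ha' : p a = some b')
  exact hne (by simpa [ha] using ha')

theorem maxPartner_ne_none {M N : StableMatching I} {a : A} (h : M.toMatching.partner a ≠ none) :
    maxPartner M N a ≠ none := by
  intro he
  have h1 := rank_maxPartner M N a
  rw [he] at h1
  have h2 := M.rank_none_le a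
  exact h (stuRank_inj.1 (show M.rank a = stuRank I a none by omega))

/-- No student matched in M becomes unmatched, so the schoolwise inequalities of `maxPartner_fiber`
have equal sums and are all tight. -/
theorem ncard_maxPartner (M N : StableMatching I) (b : B) :
    {a | maxPartner M N a = some b}.ncard = (M.students b).ncard := by
  have h1 := fun b => (maxPartner_fiber M N b).2
  have h2 : ∑ b, (M.students b).ncard ≤ ∑ b, {a | maxPartner M N a = some b}.ncard := by
    rw [sum_ncard_fiber]
    simp only [students]
    rw [sum_ncard_fiber]
    exact Set.ncard_le_ncard (fun a ha => maxPartner_ne_none ha) (Set.toFinite _)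
  have h3 := Finset.sum_le_sum (s := Finset.univ) fun b _ => h1 b
  exact (Finset.sum_eq_sum_iff_of_le fun b _ => h1 b).1 (le_antisymm h3 h2) b (Finset.mem_univ b)

/-- Every school has the same number of students in all stable matchings. -/
theorem ncard_students_eq (M N : StableMatching I) (b : B) :
    (M.students b).ncard = (N.students b).ncard := by
  rw [← ncard_maxPartner M N, maxPartner_comm, ncard_maxPartner]

theorem maxPartner_eq_none_iff (M N : StableMatching I) (a : A) :
    maxPartner M N a = none ↔ M.toMatching.partner a = none := by
  have hsub : {a | M.toMatching.partner a ≠ none} ⊆ {a | maxPartner M N a ≠ none} :=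
    fun a ha => maxPartner_ne_none ha
  have hc : {a | maxPartner M N a ≠ none}.ncard ≤ {a | M.toMatching.partner a ≠ none}.ncard := by
    rw [← sum_ncard_fiber, ← sum_ncard_fiber]
    exact Finset.sum_le_sum fun b _ => (maxPartner_fiber M N b).2
  have he := Set.eq_of_subset_of_ncard_le hsub hc (Set.toFinite _)
  exact not_iff_not.1 (Set.ext_iff.1 he a).symm

/-- The same students are matched in all stable matchings. -/
theorem partner_eq_none_iff (M N : StableMatching I) (a : A) :
    M.toMatching.partner a = none ↔ N.toMatching.partner a = none := by
  rw [← maxPartner_eq_none_iff M N, maxPartner_comm, maxPartner_eq_none_iff]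

theorem schoolPartners_eq {M : Matching I} {N : StableMatching I} {b : B}
    (h : {a | M.partner a = some b} = N.students b) :
    M.schoolPartners b = N.toMatching.schoolPartners b := by
  ext x
  have h1 : ∀ a, M.partner a = some b ↔ N.toMatching.partner a = some b := Set.ext_iff.1 h
  simp only [Matching.schoolPartners, h1]

theorem maxPartner_fiber_eq (M N : StableMatching I) (b : B) :
    {a | maxPartner M N a = some b} = M.students b ∨
      {a | maxPartner M N a = some b} = N.students b := by
  rcases (maxPartner_fiber M N b).1 with h | h
  · exact Or.inl (Set.eq_of_subset_of_ncard_le h (ncard_maxPartner M N b).ge (Set.toFinite _))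
  · refine Or.inr (Set.eq_of_subset_of_ncard_le h ?_ (Set.toFinite _))
    rw [ncard_maxPartner, ncard_students_eq]

theorem minPartner_fiber_of_max {M N : StableMatching I} {b : B}
    (h : {a | maxPartner M N a = some b} = M.students b) :
    {a | minPartner M N a = some b} = N.students b := by
  ext a
  have := Set.ext_iff.1 h a
  simp only [Set.mem_ofPred_eq, mem_students, maxPartner, minPartner] at this ⊢
  split_ifs at this ⊢ with h1
  · exact this.symm
  · rfl

/-- When every student and every school keeps its partners from some stable matching, individual
rationality is inherited and only blocking pairs need to be excluded. -/
theorem isStable_of_fiber {p : Matching I} (hp : ∀ a, ∃ M : StableMatching I,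
    p.partner a = M.toMatching.partner a)
    (hf : ∀ b, ∃ M : StableMatching I, {a | p.partner a = some b} = M.students b)
    (hb : ∀ a b, stuRank I a (p.partner a) < stuRank I a (some b) →
      ∀ x ∈ p.schoolPartners b, schRank I b (some a) ≤ schRank I b x) : p.IsStable := by
  refine ⟨?_, ?_, ?_⟩
  · rintro ⟨a, b, h1, x, hx, h2⟩
    rw [stuPref_iff] at h1
    rw [schPref_iff] at h2
    exact absurd h2 (not_lt.2 (hb a b h1 x hx))
  · rintro ⟨a, ha⟩
    obtain ⟨M, hM⟩ := hp a
    exact M.stable.2.1 ⟨a, hM ▸ ha⟩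
  · rintro ⟨b, x, hx, h⟩
    obtain ⟨M, hM⟩ := hf b
    exact M.stable.2.2 ⟨b, x, schoolPartners_eq hM ▸ hx, h⟩

theorem exists_rank_eq_max (M N : StableMatching I) :
    ∃ J : StableMatching I, ∀ a, J.rank a = max (M.rank a) (N.rank a) := by
  let p : Matching I := ⟨maxPartner M N, fun b => (ncard_maxPartner M N b).le.trans
    (M.card_students_le b)⟩
  refine ⟨⟨p, isStable_of_fiber (fun a => ?_) (fun b => ?_) fun a b hab x hx => ?_⟩,
    rank_maxPartner M N⟩
  · change ∃ M', maxPartner M N a = _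
    unfold maxPartner
    split_ifs
    exacts [⟨N, rfl⟩, ⟨M, rfl⟩]
  · exact (maxPartner_fiber_eq M N b).elim (fun h => ⟨M, h⟩) fun h => ⟨N, h⟩
  · have hr : stuRank I a (p.partner a) = _ := rank_maxPartner M N a
    rcases maxPartner_fiber_eq M N b with h | h
    · rw [schoolPartners_eq (M := p) h] at hx
      exact M.schRank_le_of_rank_lt (by omega) hx
    · rw [schoolPartners_eq (M := p) h] at hx
      exact N.schRank_le_of_rank_lt (by omega) hx

/-- This excludes blocking pairs for the meet at a school that keeps its students from N. -/
theorem schRank_le_of_minPartner {M N : StableMatching I} {a : A} {b : B}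
    (hfib : {a | maxPartner M N a = some b} = M.students b)
    (h : min (M.rank a) (N.rank a) < stuRank I a (some b)) {x : Option A}
    (hx : x ∈ N.toMatching.schoolPartners b) : schRank I b (some a) ≤ schRank I b x := by
  by_cases hN : N.rank a < stuRank I a (some b)
  · exact N.schRank_le_of_rank_lt hN hx
  have hM : M.rank a < stuRank I a (some b) := by omega
  have hMle : ∀ y ∈ M.toMatching.schoolPartners b, schRank I b (some a) ≤ schRank I b y :=
    fun y hy => M.schRank_le_of_rank_lt hM hy
  rcases hx with ⟨a', rfl, ha'⟩ | ⟨rfl, hx⟩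
  · by_contra hlt
    have ha'M : a' ∉ M.students b := fun h => hlt (hMle _ (Or.inl ⟨a', rfl, h⟩))
    -- Both matchings send equally many students to `b`, so a student gained under N is balanced by
    -- a student `a''` lost. As `b` keeps M in the join, `a''` strictly prefers M; hence `a'` is
    -- better for `b` than `a''`, who is at least as good as `a`.
    have : ∃ a'' ∈ M.students b, a'' ∉ N.students b := by
      by_contra! hall
      have := Set.eq_of_subset_of_ncard_le (fun x hx => hall x hx)
        (ncard_students_eq M N b).ge (Set.toFinite _)
      exact ha'M (this ▸ ha')
    obtain ⟨a'', h1, h2⟩ := this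
    have h3 : maxPartner M N a'' = some b := (Set.ext_iff.1 hfib a'').2 h1
    have h4 : N.rank a'' < M.rank a'' := by
      unfold maxPartner at h3
      split_ifs at h3 with h5
      · exact absurd h3 h2
      · omega
    have h5 := (full_of_rank_lt h1 h4).2 a' ha'
    have h6 := hMle _ (Or.inl ⟨a'', rfl, h1⟩)
    omega
  · exact hMle _ (Or.inr ⟨rfl, (ncard_students_eq M N b).trans_lt hx⟩)

theorem exists_rank_eq_min (M N : StableMatching I) :
    ∃ K : StableMatching I, ∀ a, K.rank a = min (M.rank a) (N.rank a) := by
  have hfib : ∀ b, ({a | maxPartner M N a = some b} = M.students b ∧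
      {a | minPartner M N a = some b} = N.students b) ∨
      ({a | maxPartner N M a = some b} = N.students b ∧
      {a | minPartner M N a = some b} = M.students b) := by
    intro b
    rcases maxPartner_fiber_eq M N b with h | h
    · exact Or.inl ⟨h, minPartner_fiber_of_max h⟩
    · rw [maxPartner_comm] at h
      exact Or.inr ⟨h, minPartner_comm M N ▸ minPartner_fiber_of_max h⟩
  let p : Matching I := ⟨minPartner M N, fun b => by
    rcases hfib b with h | h
    · exact h.2 ▸ N.card_students_le b
    · exact h.2 ▸ M.card_students_le b⟩
  refine ⟨⟨p, isStable_of_fiber (fun a => ?_) (fun b => ?_) fun a b hab x hx => ?_⟩,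
    rank_minPartner M N⟩
  · change ∃ M', minPartner M N a = _
    unfold minPartner
    split_ifs
    exacts [⟨M, rfl⟩, ⟨N, rfl⟩]
  · exact (hfib b).elim (fun h => ⟨N, h.2⟩) fun h => ⟨M, h.2⟩
  · have hr : stuRank I a (p.partner a) = _ := rank_minPartner M N a
    rcases hfib b with h | h
    · rw [schoolPartners_eq (M := p) h.2] at hx
      exact schRank_le_of_minPartner h.1 (by omega) hx
    · rw [schoolPartners_eq (M := p) h.2] at hx
      exact schRank_le_of_minPartner h.1 (by omega) hx

/-! ### The lattice operations as pointwise minimum and maximum of ranks. -/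

instance : Finite (StableMatching I) :=
  Finite.of_injective (fun M => M.toMatching.partner) fun _ _ h => ext_partner h

theorem isGLB_iff_rank {M N K : StableMatching I} :
    IsGLB {M, N} K ↔ ∀ a, K.rank a = min (M.rank a) (N.rank a) := by
  have key : ∀ K : StableMatching I, (∀ a, K.rank a = min (M.rank a) (N.rank a)) →
      IsGLB {M, N} K := by
    refine fun K h => ⟨?_, fun L hL => ?_⟩
    · rintro x (rfl | rfl) <;> exact le_iff_rank.2 fun a => by rw [h a]; simp
    · refine le_iff_rank.2 fun a => ?_
      rw [h a]
      exact le_min (le_iff_rank.1 (hL (Or.inl rfl)) a) (le_iff_rank.1 (hL (Or.inr rfl)) a)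
  refine ⟨fun h => ?_, key K⟩
  obtain ⟨K', h'⟩ := exists_rank_eq_min M N
  rw [h.unique (key K' h')]
  exact h'

theorem isLUB_iff_rank {M N J : StableMatching I} :
    IsLUB {M, N} J ↔ ∀ a, J.rank a = max (M.rank a) (N.rank a) := by
  have key : ∀ K : StableMatching I, (∀ a, K.rank a = max (M.rank a) (N.rank a)) →
      IsLUB {M, N} K := by
    refine fun K h => ⟨?_, fun L hL => ?_⟩
    · rintro x (rfl | rfl) <;> exact le_iff_rank.2 fun a => by rw [h a]; simp
    · refine le_iff_rank.2 fun a => ?_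
      rw [h a]
      exact max_le (le_iff_rank.1 (hL (Or.inl rfl)) a) (le_iff_rank.1 (hL (Or.inr rfl)) a)
  refine ⟨fun h => ?_, key J⟩
  obtain ⟨K', h'⟩ := exists_rank_eq_max M N
  rw [h.unique (key K' h')]
  exact h'

/-- A matching of maximal total rank absorbs every join. -/
theorem exists_greatest [Nonempty (StableMatching I)] :
    ∃ M₀ : StableMatching I, ∀ N, N ≤ M₀ := by
  obtain ⟨M, hM⟩ := Finite.exists_max (fun M : StableMatching I => ∑ a, M.rank a)
  refine ⟨M, fun N => ?_⟩
  obtain ⟨J, hJ⟩ := exists_rank_eq_max M N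
  have hle : ∀ a, M.rank a ≤ J.rank a := fun a => by rw [hJ]; exact le_max_left _ _
  have h := (Finset.sum_eq_sum_iff_of_le fun a _ => hle a).1
    (le_antisymm (Finset.sum_le_sum fun a _ => hle a) (hM J))
  refine le_iff_rank.2 fun a => ?_
  rw [h a (Finset.mem_univ a), hJ]
  exact le_max_right _ _

end StableMatching
open StableMatching

/-! ### Rotations -/

theorem exists_rank_lt {M N : StableMatching I} (h : M < N) : ∃ a, M.rank a < N.rank a := by
  by_contra! hc
  exact h.not_ge (le_iff_rank.2 hc)

theorem rank_mono {M N : StableMatching I} (h : M ≤ N) (a : A) : M.rank a ≤ N.rank a :=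
  le_iff_rank.1 h a

/-- A stable matching does not separate the students that move in an immediate descent. -/
theorem rank_le_or_le_rank_of_covBy {N' N : StableMatching I} (h : N' ⋖ N) (M : StableMatching I) :
    (∀ a, N'.rank a < N.rank a → M.rank a ≤ N'.rank a) ∨
      ∀ a, N'.rank a < N.rank a → N.rank a ≤ M.rank a := by
  -- The matching `(M ∨ N') ∧ N` lies between `N'` and `N`, hence equals one of them; the two cases
  -- give the two alternatives.
  obtain ⟨J, hJ⟩ := exists_rank_eq_max M N'
  obtain ⟨K, hK⟩ := exists_rank_eq_min J N
  have hle := rank_mono h.le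
  have h1 : N' ≤ K := le_iff_rank.2 fun a => by have := hle a; rw [hK, hJ]; omega
  have h2 : K ≤ N := le_iff_rank.2 fun a => by rw [hK]; omega
  rcases h.eq_or_eq h1 h2 with rfl | rfl
  · refine Or.inl fun a ha => ?_
    have := hK a
    rw [hJ] at this
    omega
  · refine Or.inr fun a ha => ?_
    have := hK a
    rw [hJ] at this
    omega

/-- Pairs with the student side empty cancel, since a school has the same number of students in all
stable matchings. -/
theorem mem_pairs_diff {M N : StableMatching I} {p : Option A × Option B} :
    p ∈ M.toMatching.pairs \ N.toMatching.pairs ↔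
      ∃ a, p = (some a, M.toMatching.partner a) ∧ M.rank a ≠ N.rank a := by
  have hnone : ∀ b, none ∈ M.toMatching.schoolPartners b ↔
      none ∈ N.toMatching.schoolPartners b := by
    intro b
    have := ncard_students_eq M N b
    simp only [students] at this
    simp [Matching.schoolPartners, this]
  simp only [Ne, rank_eq_iff]
  constructor
  · rintro ⟨⟨a, rfl⟩ | ⟨b, rfl, hb⟩, h2⟩
    · exact ⟨a, rfl, fun he => h2 (Or.inl ⟨a, by rw [he]⟩)⟩
    · exact absurd (Or.inr ⟨b, rfl, (hnone b).1 hb⟩) h2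
  · rintro ⟨a, rfl, hne⟩
    refine ⟨Or.inl ⟨a, rfl⟩, ?_⟩
    rintro (⟨a', h⟩ | ⟨b, h, -⟩)
    · simp only [Prod.mk.injEq, Option.some.injEq] at h
      obtain ⟨rfl, h⟩ := h
      exact hne h
    · simp at h

theorem partner_eq_of_rotationPair_eq {N N' S S' : StableMatching I}
    (h : rotationPair N N' = rotationPair S S') {a : A} (ha : N.rank a ≠ N'.rank a) :
    S.toMatching.partner a = N.toMatching.partner a ∧
      S'.toMatching.partner a = N'.toMatching.partner a := by
  simp only [rotationPair, Prod.mk.injEq] at h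
  constructor
  · have : (some a, N.toMatching.partner a) ∈ S.toMatching.pairs \ S'.toMatching.pairs :=
      h.1 ▸ mem_pairs_diff.2 ⟨a, rfl, ha⟩
    obtain ⟨a', h1, -⟩ := mem_pairs_diff.1 this
    simp only [Prod.mk.injEq, Option.some.injEq] at h1
    obtain ⟨rfl, h1⟩ := h1
    exact h1.symm
  · have : (some a, N'.toMatching.partner a) ∈ S'.toMatching.pairs \ S.toMatching.pairs :=
      h.2 ▸ mem_pairs_diff.2 ⟨a, rfl, ha.symm⟩
    obtain ⟨a', h1, -⟩ := mem_pairs_diff.1 this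
    simp only [Prod.mk.injEq, Option.some.injEq] at h1
    obtain ⟨rfl, h1⟩ := h1
    exact h1.symm

theorem rank_eq_of_rotationPair_eq {N N' S S' : StableMatching I}
    (h : rotationPair N N' = rotationPair S S') {a : A} (ha : N.rank a ≠ N'.rank a) :
    S.rank a = N.rank a ∧ S'.rank a = N'.rank a := by
  obtain ⟨h1, h2⟩ := partner_eq_of_rotationPair_eq h ha
  exact ⟨rank_eq_iff.2 h1, rank_eq_iff.2 h2⟩

/-- Two immediate descents that share the move of one student share all their moves. -/
theorem rank_eq_of_covBy {N N' S S' : StableMatching I} (hN : N' ⋖ N) (hS : S' ⋖ S) {a : A}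
    (ha : N'.rank a < N.rank a) (h : S.rank a = N.rank a) (h' : S'.rank a = N'.rank a) {c : A}
    (hc : N'.rank c < N.rank c) : S.rank c = N.rank c ∧ S'.rank c = N'.rank c := by
  -- Each dichotomy is decided at `a` and then read at `c`. The first two show that `c` also moves
  -- from `S` to `S'`, which makes the last two applicable at `c`.
  have e1 := rank_le_or_le_rank_of_covBy hN S
  have e2 := rank_le_or_le_rank_of_covBy hN S'
  have e3 := rank_le_or_le_rank_of_covBy hS N
  have e4 := rank_le_or_le_rank_of_covBy hS N'
  have g1 : N.rank c ≤ S.rank c := by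
    rcases e1 with e | e
    · have := e a ha; omega
    · exact e c hc
  have g2 : S'.rank c ≤ N'.rank c := by
    rcases e2 with e | e
    · exact e c hc
    · have := e a ha; omega
  have hc' : S'.rank c < S.rank c := by omega
  have ha' : S'.rank a < S.rank a := by omega
  have g3 : S.rank c ≤ N.rank c := by
    rcases e3 with e | e
    · have := e a ha'; omega
    · exact e c hc'
  have g4 : N'.rank c ≤ S'.rank c := by
    rcases e4 with e | e
    · exact e c hc'
    · have := e a ha'; omega
  omega

theorem rotationPair_eq_of_covBy {N N' S S' : StableMatching I} (hN : N' ⋖ N) (hS : S' ⋖ S) {a : A}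
    (ha : N'.rank a < N.rank a) (h : S.rank a = N.rank a) (h' : S'.rank a = N'.rank a) :
    rotationPair N N' = rotationPair S S' := by
  have key : ∀ c, (N.rank c ≠ N'.rank c ∨ S.rank c ≠ S'.rank c) →
      S.rank c = N.rank c ∧ S'.rank c = N'.rank c := by
    rintro c (hc | hc)
    · exact rank_eq_of_covBy hN hS ha h h' (lt_of_le_of_ne (rank_mono hN.le c) hc.symm)
    · have := rank_eq_of_covBy hS hN (by omega) h.symm h'.symm
        (lt_of_le_of_ne (rank_mono hS.le c) hc.symm)
      exact ⟨this.1.symm, this.2.symm⟩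
  unfold rotationPair
  congr 1
  · ext p
    rw [mem_pairs_diff, mem_pairs_diff]
    refine exists_congr fun c => ⟨fun ⟨h1, h2⟩ => ?_, fun ⟨h1, h2⟩ => ?_⟩
    · have := key c (Or.inl h2)
      exact ⟨by rw [h1, rank_eq_iff.1 this.1], by omega⟩
    · have := key c (Or.inr h2)
      exact ⟨by rw [h1, rank_eq_iff.1 this.1], by omega⟩
  · ext p
    rw [mem_pairs_diff, mem_pairs_diff]
    refine exists_congr fun c => ⟨fun ⟨h1, h2⟩ => ?_, fun ⟨h1, h2⟩ => ?_⟩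
    · have := key c (Or.inl h2.symm)
      exact ⟨by rw [h1, rank_eq_iff.1 this.2], by omega⟩
    · have := key c (Or.inr h2.symm)
      exact ⟨by rw [h1, rank_eq_iff.1 this.2], by omega⟩

/-! ### Independence of the eliminated rotations from the chosen chain. -/

/-- The rotations all of whose moves lie above `M`. -/
def rotationsAbove (M : StableMatching I) : Set (Rotation I) :=
  {ρ | ∃ N N' : StableMatching I, N' ⋖ N ∧ ρ.1 = rotationPair N N' ∧
    ∀ a, N'.rank a < N.rank a → M.rank a ≤ N'.rank a}

theorem mem_rotationsAbove_iff {ρ : Rotation I} {N N' : StableMatching I} (h : N' ⋖ N)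
    (hρ : ρ.1 = rotationPair N N') {a : A} (ha : N'.rank a < N.rank a) (M : StableMatching I) :
    ρ ∈ rotationsAbove M ↔ M.rank a ≤ N'.rank a := by
  constructor
  · rintro ⟨S, S', -, hS, hM⟩
    have := rank_eq_of_rotationPair_eq (hρ.symm.trans hS) ha.ne'
    have := hM a (by omega)
    omega
  · intro hM
    refine ⟨N, N', h, hρ, (rank_le_or_le_rank_of_covBy h M).resolve_right fun hc => ?_⟩
    have := hc a ha
    omega

theorem elimination_antitone {s : ℕ → StableMatching I} {k : ℕ} (hs : ∀ i < k, s (i + 1) ⋖ s i)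
    {i j : ℕ} (hij : i ≤ j) (hj : j ≤ k) : s j ≤ s i := by
  induction j, hij using Nat.le_induction with
  | base => exact le_rfl
  | succ n _ ih => exact (hs n (by omega)).le.trans (ih (by omega))

/-- The right-hand side does not mention the chain, so all chains from the top to M eliminate the
same rotations. -/
theorem IsElimination.eq_rotationsAbove {R : Set (Rotation I)} {M : StableMatching I}
    (h : IsElimination R M) : R = rotationsAbove M := by
  obtain ⟨k, s, h0, rfl, hs, rfl⟩ := h
  ext ρ
  constructor
  · rintro ⟨i, hi, hρ⟩
    exact ⟨s i, s (i + 1), hs i hi, hρ, fun a _ =>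
      rank_mono (elimination_antitone hs (by omega) le_rfl) a⟩
  · rintro ⟨N, N', hN, hρ, hM⟩
    obtain ⟨a, ha⟩ := exists_rank_lt hN.lt
    -- The rotation is eliminated at the step where the chain first brings `a` down to `N'` or
    -- below. That index is positive because `s 0` is above `N`. By the dichotomy the chain was at
    -- `N` or above just before, and the dichotomy for the step itself forces equality at both ends.
    have hex : ∃ i, (s i).rank a ≤ N'.rank a := ⟨k, hM a ha⟩
    classical
    obtain ⟨i, hi⟩ : ∃ i, Nat.find hex = i + 1 := by
      refine Nat.exists_eq_succ_of_ne_zero fun hz => ?_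
      have h1 := Nat.find_spec hex
      rw [hz] at h1
      have := rank_mono (h0 N) a
      omega
    have hik : i < k := by
      have := Nat.find_min' hex (hM a ha)
      omega
    have hlow : (s (i + 1)).rank a ≤ N'.rank a := hi ▸ Nat.find_spec hex
    have hup : N.rank a ≤ (s i).rank a := by
      have h1 : ¬ (s i).rank a ≤ N'.rank a := Nat.find_min hex (by omega)
      rcases rank_le_or_le_rank_of_covBy hN (s i) with e | e
      · exact absurd (e a ha) h1
      · exact e a ha
    have hm : (s (i + 1)).rank a < (s i).rank a := by omega
    refine ⟨i, hik, hρ.trans (rotationPair_eq_of_covBy hN (hs i hik) ha ?_ ?_)⟩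
    · rcases rank_le_or_le_rank_of_covBy (hs i hik) N with e | e
      · have := e a hm; omega
      · have := e a hm; omega
    · rcases rank_le_or_le_rank_of_covBy (hs i hik) N' with e | e
      · have := e a hm; omega
      · have := e a hm; omega

theorem exists_isElimination (M : StableMatching I) : ∃ R, IsElimination R M := by
  have : Nonempty (StableMatching I) := ⟨M⟩
  obtain ⟨M₀, h₀⟩ := exists_greatest (I := I)
  obtain ⟨s, h0, k, hk, hs⟩ := exists_covBy_seq_of_wellFoundedLT_wellFoundedGT_of_le
    (α := (StableMatching I)ᵒᵈ) (x := OrderDual.toDual M₀) (y := OrderDual.toDual M) (h₀ M)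
  refine ⟨_, k, fun i => OrderDual.ofDual (s i), ?_, ?_, ?_, rfl⟩
  · beta_reduce; rw [h0]; exact h₀
  · beta_reduce; rw [hk]; rfl
  · exact fun i hi => (hs i hi).ofDual

theorem rotationsOf_eq_rotationsAbove (M : StableMatching I) :
    rotationsOf M = rotationsAbove M := by
  obtain ⟨R, hR⟩ := exists_isElimination M
  ext ρ
  constructor
  · rintro ⟨R', hR', h⟩
    rwa [← hR'.eq_rotationsAbove]
  · intro h
    exact ⟨R, hR, hR.eq_rotationsAbove ▸ h⟩

theorem isElimination_iff {R : Set (Rotation I)} {M : StableMatching I} :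
    IsElimination R M ↔ R = rotationsOf M := by
  rw [rotationsOf_eq_rotationsAbove]
  refine ⟨fun h => h.eq_rotationsAbove, ?_⟩
  rintro rfl
  obtain ⟨R, hR⟩ := exists_isElimination M
  rwa [← hR.eq_rotationsAbove]

theorem mem_rotationsOf_iff {ρ : Rotation I} {N N' : StableMatching I} (h : N' ⋖ N)
    (hρ : ρ.1 = rotationPair N N') {a : A} (ha : N'.rank a < N.rank a) (M : StableMatching I) :
    ρ ∈ rotationsOf M ↔ M.rank a ≤ N'.rank a := by
  rw [rotationsOf_eq_rotationsAbove, mem_rotationsAbove_iff h hρ ha]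

/-- The elimination of a rotation can be read off from the partner of one matched student. -/
theorem exists_rank_threshold (ρ : Rotation I) :
    ∃ (a : A) (c : ℕ), (∀ M : StableMatching I, ρ ∈ rotationsOf M ↔ M.rank a ≤ c) ∧
      ∀ M : StableMatching I, M.toMatching.partner a ≠ none := by
  obtain ⟨N, N', h, hρ⟩ := ρ.2
  obtain ⟨a, ha⟩ := exists_rank_lt h.lt
  refine ⟨a, N'.rank a, mem_rotationsOf_iff h hρ ha, fun M hM => ?_⟩
  -- A student unmatched in one stable matching is unmatched in all, and would not move between `N`
  -- and `N'`.
  have h1 := (partner_eq_none_iff M N a).1 hM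
  have h2 := (partner_eq_none_iff M N' a).1 hM
  exact ha.ne (rank_eq_iff.2 (h2.trans h1.symm))

/-- A minimum is below a threshold exactly when one of its arguments is. -/
theorem rotationsOf_min {M N K : StableMatching I}
    (h : ∀ a, K.rank a = min (M.rank a) (N.rank a)) :
    rotationsOf K = rotationsOf M ∪ rotationsOf N := by
  ext ρ
  obtain ⟨a, c, hc, -⟩ := exists_rank_threshold ρ
  rw [Set.mem_union, hc, hc, hc, h, min_le_iff]

theorem rotationsOf_max {M N J : StableMatching I}
    (h : ∀ a, J.rank a = max (M.rank a) (N.rank a)) :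
    rotationsOf J = rotationsOf M ∩ rotationsOf N := by
  ext ρ
  obtain ⟨a, c, hc, -⟩ := exists_rank_threshold ρ
  rw [Set.mem_inter_iff, hc, hc, hc, h, max_le_iff]

theorem rotationsOf_subset_iff {M N : StableMatching I} :
    rotationsOf N ⊆ rotationsOf M ↔ M ≤ N := by
  constructor
  · intro h
    obtain ⟨K, hK⟩ := exists_rank_eq_min M N
    have hKM : K ≤ M := le_iff_rank.2 fun a => by rw [hK]; omega
    rcases hKM.eq_or_lt with rfl | hlt
    · exact le_iff_rank.2 fun a => by rw [hK]; omega
    · exfalso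
      -- The rotation from `M` down to `P` is eliminated in the meet `K`, whose rotations are only
      -- those of `M`; but it cannot be eliminated in `M`, where it is exposed.
      obtain ⟨P, hKP, hP⟩ := exists_le_covBy_of_lt hlt
      obtain ⟨a, ha⟩ := exists_rank_lt hP.lt
      have hmem := mem_rotationsOf_iff (ρ := ⟨_, M, P, hP, rfl⟩) hP rfl ha
      have h1 := (hmem K).2 (rank_mono hKP a)
      rw [rotationsOf_min hK, Set.union_eq_left.2 h] at h1
      have := (hmem M).1 h1
      omega
  · intro h ρ
    obtain ⟨a, c, hc, -⟩ := exists_rank_threshold ρ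
    rw [hc, hc]
    exact (rank_mono h a).trans

theorem rotationsOf_injective : Function.Injective (rotationsOf (I := I)) := fun _ _ h =>
  le_antisymm (rotationsOf_subset_iff.1 h.ge) (rotationsOf_subset_iff.1 h.le)

/-- A rotation on the chain is exposed where it is eliminated, so everything above it was eliminated
earlier on the chain. -/
theorem isUpperClosed_rotationsOf (M : StableMatching I) : IsUpperClosed (rotationsOf M) := by
  rintro ρ ⟨R, ⟨k, s, h0, rfl, hs, rfl⟩, i, hi, hρ⟩ ρ' (rfl | h)
  · exact ⟨_, ⟨k, s, h0, rfl, hs, rfl⟩, i, hi, hρ⟩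
  · exact rotationsOf_subset_iff.2 (elimination_antitone hs hi.le le_rfl)
      (h (s i) ⟨_, hs i hi, hρ⟩ _ (isElimination_iff.2 rfl))

theorem rotationsOf_of_covBy {M P : StableMatching I} (h : M ⋖ P) :
    (⟨_, P, M, h, rfl⟩ : Rotation I) ∉ rotationsOf P ∧
      rotationsOf M = insert ⟨_, P, M, h, rfl⟩ (rotationsOf P) := by
  obtain ⟨a, ha⟩ := exists_rank_lt h.lt
  have hmem := mem_rotationsOf_iff (ρ := ⟨_, P, M, h, rfl⟩) h rfl ha
  refine ⟨fun hc => ?_, Set.Subset.antisymm ?_ (Set.insert_subset ((hmem M).2 le_rfl)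
    (rotationsOf_subset_iff.2 h.le))⟩
  · have := (hmem P).1 hc
    omega
  · obtain ⟨R, k, s, h0, rfl, hs, rfl⟩ := exists_isElimination P
    have : IsElimination {ρ | ∃ i < k + 1, ρ.1 =
        rotationPair (if i ≤ k then s i else M) (if i + 1 ≤ k then s (i + 1) else M)} M := by
      refine ⟨k + 1, fun i => if i ≤ k then s i else M, by simpa using h0, by simp, ?_, rfl⟩
      intro i hi
      rcases Nat.lt_succ_iff_lt_or_eq.1 hi with hi | rfl
      · simpa [hi.le, Nat.succ_le_of_lt hi] using hs i hi
      · simpa using h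
    rw [← isElimination_iff.1 this]
    rintro ρ ⟨i, hi, hρ⟩
    rcases Nat.lt_succ_iff_lt_or_eq.1 hi with hi | rfl
    · simp only [hi.le, Nat.succ_le_of_lt hi, if_true] at hρ
      exact Or.inr ⟨_, ⟨k, s, h0, rfl, hs, rfl⟩, i, hi, hρ⟩
    · simp only [le_refl, if_true, Nat.not_succ_le_self, if_false] at hρ
      exact Or.inl (Subtype.ext hρ)

theorem rotationsOf_eq_empty {M₀ : StableMatching I} (h : ∀ N, N ≤ M₀) : rotationsOf M₀ = ∅ := by
  symm
  rw [← isElimination_iff]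
  exact ⟨0, fun _ => M₀, h, rfl, by simp, by simp⟩

/-! ### The family of rotation sets of a set of stable matchings -/

/-- The sets of rotations of the members of `F`. -/
def rotationFamily (F : Set (StableMatching I)) : Set (Set (Rotation I)) := rotationsOf '' F

theorem IsSublattice.supClosed {F : Set (StableMatching I)} (h : IsSublattice F) :
    SupClosed (rotationFamily F) := by
  rintro _ ⟨M, hM, rfl⟩ _ ⟨N, hN, rfl⟩
  obtain ⟨-, K, hK, hglb⟩ := h M hM N hN
  exact ⟨K, hK, rotationsOf_min (isGLB_iff_rank.1 hglb)⟩

theorem IsSublattice.infClosed {F : Set (StableMatching I)} (h : IsSublattice F) :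
    InfClosed (rotationFamily F) := by
  rintro _ ⟨M, hM, rfl⟩ _ ⟨N, hN, rfl⟩
  obtain ⟨⟨J, hJ, hlub⟩, -⟩ := h M hM N hN
  exact ⟨J, hJ, rotationsOf_max (isLUB_iff_rank.1 hlub)⟩

theorem isSublattice_of_closed {F : Set (StableMatching I)} (hs : SupClosed (rotationFamily F))
    (hi : InfClosed (rotationFamily F)) : IsSublattice F := by
  intro M hM N hN
  constructor
  · obtain ⟨J, hJ⟩ := exists_rank_eq_max M N
    obtain ⟨J', hJ', he⟩ := hi ⟨M, hM, rfl⟩ ⟨N, hN, rfl⟩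
    replace he := he.trans (rotationsOf_max hJ).symm
    exact ⟨J, rotationsOf_injective he ▸ hJ', isLUB_iff_rank.2 hJ⟩
  · obtain ⟨K, hK⟩ := exists_rank_eq_min M N
    obtain ⟨K', hK', he⟩ := hs ⟨M, hM, rfl⟩ ⟨N, hN, rfl⟩
    replace he := he.trans (rotationsOf_min hK).symm
    exact ⟨K, rotationsOf_injective he ▸ hK', isGLB_iff_rank.2 hK⟩

theorem isUpperClosed_and_isElimination_iff {F : Set (StableMatching I)} {R : Set (Rotation I)} :
    (IsUpperClosed R ∧ ∃ M ∈ F, IsElimination R M) ↔ R ∈ rotationFamily F := by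
  constructor
  · rintro ⟨-, M, hM, hR⟩
    exact ⟨M, hM, (isElimination_iff.1 hR).symm⟩
  · rintro ⟨M, hM, rfl⟩
    exact ⟨isUpperClosed_rotationsOf M, M, hM, isElimination_iff.2 rfl⟩

/-- Birkhoff's description of a nonempty ring of sets by implications between its elements. -/
theorem mem_iff_of_supClosed_of_infClosed {X : Type*} [Finite X] {𝓕 : Set (Set X)}
    (hs : SupClosed 𝓕) (hi : InfClosed 𝓕) (R : Set X) :
    R ∈ 𝓕 ↔ 𝓕.Nonempty ∧ (∀ x ∈ R, ∃ T ∈ 𝓕, x ∈ T) ∧ (∀ x ∉ R, ∃ T ∈ 𝓕, x ∉ T) ∧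
      ∀ x ∈ R, ∀ y ∉ R, ∃ T ∈ 𝓕, x ∈ T ∧ y ∉ T := by
  constructor
  · intro h
    exact ⟨⟨R, h⟩, fun x hx => ⟨R, h, hx⟩, fun x hx => ⟨R, h, hx⟩,
      fun x hx y hy => ⟨R, h, hx, hy⟩⟩
  · rintro ⟨hne, h1, h2, h3⟩
    -- The empty set is the intersection of all members. A nonempty `R` is the union, over its
    -- elements, of the least member containing that element; the last condition keeps these members
    -- inside `R`.
    rcases R.eq_empty_or_nonempty with rfl | hR
    · have : sInf 𝓕 ∈ 𝓕 := hi.sInf_mem_of_nonempty (Set.toFinite _) hne subset_rfl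
      convert this
      symm
      rw [Set.sInf_eq_sInter, Set.eq_empty_iff_forall_notMem]
      intro x hx
      obtain ⟨T, hT, hxT⟩ := h2 x (Set.notMem_empty x)
      exact hxT (hx T hT)
    · have hmem : ∀ x ∈ R, sInf {T ∈ 𝓕 | x ∈ T} ∈ 𝓕 := fun x hx =>
        hi.sInf_mem_of_nonempty (Set.toFinite _) (h1 x hx) fun T hT => hT.1
      have := hs.biSup_mem_of_nonempty (Set.toFinite R) hR hmem
      convert this
      apply Set.Subset.antisymm
      · intro x hx
        simp only [Set.iSup_eq_iUnion, Set.mem_iUnion]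
        exact ⟨x, hx, fun T hT => hT.2⟩
      · simp only [Set.iSup_eq_iUnion, Set.iUnion_subset_iff]
        intro x hx y hy
        by_contra hyR
        obtain ⟨T, hT, hxT, hyT⟩ := h3 x hx y hyR
        exact hyT (hy T ⟨hT, hxT⟩)

/-! ### Linear objectives in terms of rotations -/

open Classical in
/-- The total weight of the pairs of `M`. -/
noncomputable def pairWeight (w : A → B → ℝ) (M : StableMatching I) : ℝ :=
  ∑ a, ∑ b, if M.toMatching.partner a = some b then w a b else 0

theorem pairWeight_sub_eq (w : A → B → ℝ) {N N' S S' : StableMatching I}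
    (h : rotationPair N N' = rotationPair S S') :
    pairWeight w N' - pairWeight w N = pairWeight w S' - pairWeight w S := by
  unfold pairWeight
  rw [← Finset.sum_sub_distrib, ← Finset.sum_sub_distrib]
  refine Finset.sum_congr rfl fun a _ => ?_
  by_cases ha : N.rank a = N'.rank a
  · have hS : S.rank a = S'.rank a := by
      by_contra hS
      obtain ⟨h1, h2⟩ := rank_eq_of_rotationPair_eq h.symm hS
      omega
    rw [rank_eq_iff.1 ha, rank_eq_iff.1 hS, sub_self, sub_self]
  · obtain ⟨h1, h2⟩ := partner_eq_of_rotationPair_eq h ha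
    rw [h1, h2]

open Classical in
/-- The total weight of a linear objective is affine in the set of eliminated rotations. -/
theorem exists_rotation_weights (w : A → B → ℝ) :
    ∃ (c : ℝ) (v : Rotation I → ℝ), ∀ M : StableMatching I,
      pairWeight w M = c + ∑ ρ, if ρ ∈ rotationsOf M then v ρ else 0 := by
  rcases isEmpty_or_nonempty (StableMatching I) with he | hne
  · exact ⟨0, 0, fun M => he.elim M⟩
  obtain ⟨M₀, h₀⟩ := exists_greatest (I := I)
  -- The weight of a rotation is measured on one chosen descent; by `pairWeight_sub_eq` the choice
  -- does not matter.
  choose S S' hS hρ using fun ρ : Rotation I => ρ.2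
  refine ⟨pairWeight w M₀, fun ρ => pairWeight w (S' ρ) - pairWeight w (S ρ), fun M => ?_⟩
  induction M using (wellFounded_gt (α := StableMatching I)).induction with
  | _ M ih =>
  rcases (h₀ M).eq_or_lt with rfl | hlt
  · simp [rotationsOf_eq_empty h₀]
  · obtain ⟨P, hP, -⟩ := exists_covBy_le_of_lt hlt
    obtain ⟨ρ, hval, hnot, hins⟩ : ∃ ρ : Rotation I, ρ.1 = rotationPair P M ∧
        ρ ∉ rotationsOf P ∧ rotationsOf M = insert ρ (rotationsOf P) :=
      ⟨_, rfl, rotationsOf_of_covBy hP⟩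
    have hsum : ∀ v : Rotation I → ℝ, (∑ σ, if σ ∈ rotationsOf M then v σ else 0) =
        v ρ + ∑ σ, if σ ∈ rotationsOf P then v σ else 0 := by
      intro v
      rw [hins]
      have : v ρ = ∑ σ, if σ = ρ then v σ else 0 := by simp
      rw [this, ← Finset.sum_add_distrib]
      refine Finset.sum_congr rfl fun σ _ => ?_
      by_cases h1 : σ = ρ
      · simp [h1, hnot]
      · simp [h1]
    rw [hsum, add_left_comm, ← ih P hP.lt, ← pairWeight_sub_eq w (hval.symm.trans (hρ ρ))]
    ring

/-! ### Cuts -/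

@[simp] theorem inl_mem_cutSide {R : Set (Rotation I)} {ρ : Rotation I} :
    (Sum.inl ρ : Vertex I) ∈ cutSide R ↔ ρ ∈ R := by
  simp [cutSide]

@[simp] theorem inr_mem_cutSide {R : Set (Rotation I)} {b : Bool} :
    (Sum.inr b : Vertex I) ∈ cutSide R ↔ b = false := by
  simp [cutSide]

theorem mem_cutSide_union {P Q : Set (Rotation I)} {v : Vertex I} :
    v ∈ cutSide (P ∪ Q) ↔ v ∈ cutSide P ∨ v ∈ cutSide Q := by
  cases v <;> simp

theorem mem_cutSide_inter {P Q : Set (Rotation I)} {v : Vertex I} :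
    v ∈ cutSide (P ∩ Q) ↔ v ∈ cutSide P ∧ v ∈ cutSide Q := by
  cases v <;> simp

theorem cutValue_lt_top_iff {u : Vertex I → Vertex I → ENNReal} {R : Set (Rotation I)} :
    cutValue u R < ⊤ ↔ ∀ v w, v ∈ cutSide R → w ∉ cutSide R → u v w < ⊤ := by
  classical
  simp only [cutValue, ENNReal.sum_lt_top, Finset.mem_univ, true_implies]
  refine forall₂_congr fun v w => ?_
  split_ifs with h
  · simp [h.1, h.2]
  · simp only [ENNReal.zero_lt_top, true_iff]
    exact fun h1 h2 => absurd ⟨h1, h2⟩ h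

open Classical in
theorem toReal_cutValue {u : Vertex I → Vertex I → ENNReal} {R : Set (Rotation I)}
    (h : cutValue u R < ⊤) : (cutValue u R).toReal =
      ∑ v : Vertex I, ∑ w : Vertex I,
        if v ∈ cutSide R ∧ w ∉ cutSide R then (u v w).toReal else 0 := by
  have hlt := cutValue_lt_top_iff.1 h
  have hterm : ∀ v w : Vertex I,
      (if v ∈ cutSide R ∧ w ∉ cutSide R then u v w else 0) ≠ ⊤ := by
    intro v w
    split_ifs with h1
    · exact (hlt v w h1.1 h1.2).ne
    · simp
  rw [cutValue, ENNReal.toReal_sum fun v _ => ENNReal.sum_ne_top.2 fun w _ => hterm v w]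
  refine Finset.sum_congr rfl fun v _ => ?_
  rw [ENNReal.toReal_sum fun w _ => hterm v w]
  refine Finset.sum_congr rfl fun w _ => ?_
  split_ifs <;> simp

open Classical in
/-- The capacities that enforce the implications valid on `F` and realize the rotation weights
`v`. -/
noncomputable def closureCapacity (F : Set (StableMatching I)) (v : Rotation I → ℝ) :
    Vertex I → Vertex I → ENNReal
  | Sum.inl ρ, Sum.inl σ => if ∃ T ∈ rotationFamily F, ρ ∈ T ∧ σ ∉ T then 0 else ⊤
  | Sum.inl ρ, Sum.inr true => if ∃ T ∈ rotationFamily F, ρ ∈ T then ENNReal.ofReal (v ρ) else ⊤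
  | Sum.inr false, Sum.inl ρ => if ∃ T ∈ rotationFamily F, ρ ∉ T then ENNReal.ofReal (-v ρ) else ⊤
  | Sum.inr false, Sum.inr true => if (rotationFamily F).Nonempty then 0 else ⊤
  | _, _ => 0

/-- The four kinds of possibly infinite arcs match the four conditions in
`mem_iff_of_supClosed_of_infClosed`; the arc from source to sink handles an empty F. -/
theorem cutValue_closureCapacity_lt_top_iff {F : Set (StableMatching I)} {v : Rotation I → ℝ}
    (h : IsSublattice F) (R : Set (Rotation I)) :
    cutValue (closureCapacity F v) R < ⊤ ↔ R ∈ rotationFamily F := by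
  rw [mem_iff_of_supClosed_of_infClosed h.supClosed h.infClosed, cutValue_lt_top_iff]
  have hite : ∀ (p : Prop) [Decidable p] (x : ENNReal), x < ⊤ → ((if p then x else ⊤) < ⊤ ↔ p) := by
    intro p _ x hx
    split_ifs with hp <;> simp [hp, hx]
  constructor
  · intro hc
    refine ⟨?_, fun x hx => ?_, fun x hx => ?_, fun x hx y hy => ?_⟩
    · have := hc (Sum.inr false) (Sum.inr true) (by simp) (by simp)
      simpa only [closureCapacity, hite _ _ ENNReal.zero_lt_top] using this
    · have := hc (Sum.inl x) (Sum.inr true) (by simpa) (by simp)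
      simpa only [closureCapacity, hite _ _ ENNReal.ofReal_lt_top] using this
    · have := hc (Sum.inr false) (Sum.inl x) (by simp) (by simpa)
      simpa only [closureCapacity, hite _ _ ENNReal.ofReal_lt_top] using this
    · have := hc (Sum.inl x) (Sum.inl y) (by simpa) (by simpa)
      simpa only [closureCapacity, hite _ _ ENNReal.zero_lt_top] using this
  · rintro ⟨h0, h1, h2, h3⟩ (x | x) (y | y) hx hy
    · rw [inl_mem_cutSide] at hx hy
      simpa only [closureCapacity, hite _ _ ENNReal.zero_lt_top] using h3 x hx y hy
    · rw [inl_mem_cutSide] at hx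
      obtain rfl : y = true := by simpa using hy
      simpa only [closureCapacity, hite _ _ ENNReal.ofReal_lt_top] using h1 x hx
    · rw [inl_mem_cutSide] at hy
      obtain rfl : x = false := by simpa using hx
      simpa only [closureCapacity, hite _ _ ENNReal.ofReal_lt_top] using h2 y hy
    · obtain rfl : x = false := by simpa using hx
      obtain rfl : y = true := by simpa using hy
      simpa only [closureCapacity, hite _ _ ENNReal.zero_lt_top] using h0

-- Rotations in R pay the positive part of their weight and the others pay the negative part; the
-- positive part is the weight plus the negative part.
open Classical in
theorem toReal_cutValue_closureCapacity {F : Set (StableMatching I)} {v : Rotation I → ℝ}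
    (h : IsSublattice F) {R : Set (Rotation I)} (hR : R ∈ rotationFamily F) :
    (cutValue (closureCapacity F v) R).toReal =
      (∑ ρ, if ρ ∈ R then v ρ else 0) + ∑ ρ, max (-v ρ) 0 := by
  rw [toReal_cutValue ((cutValue_closureCapacity_lt_top_iff h R).2 hR)]
  have hzero : ∀ (p : Prop) [Decidable p], (if p then (0 : ENNReal) else ⊤).toReal = 0 := by
    intro p _
    split_ifs <;> simp
  simp only [Fintype.sum_sum_type, Fintype.sum_bool, inl_mem_cutSide, inr_mem_cutSide,
    closureCapacity, hzero, ite_self, Finset.sum_const_zero, ENNReal.toReal_zero,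
    false_and, and_false, not_true, not_false_eq_true, and_true, true_and, add_zero,
    zero_add, Bool.true_eq_false]
  rw [← Finset.sum_add_distrib, ← Finset.sum_add_distrib]
  refine Finset.sum_congr rfl fun ρ _ => ?_
  by_cases hρ : ρ ∈ R
  · rw [if_pos hρ, if_pos ⟨R, hR, hρ⟩, if_neg (not_not.2 hρ), if_pos hρ, ENNReal.toReal_ofReal']
    rcases le_total 0 (v ρ) with h0 | h0
    · rw [max_eq_left h0, max_eq_right (by linarith)]
    · rw [max_eq_right h0, max_eq_left (by linarith)]; ring
  · rw [if_neg hρ, if_pos hρ, if_pos ⟨R, hR, hρ⟩, if_neg hρ, ENNReal.toReal_ofReal']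

theorem IsMWSM.minCutRepresentable {F : Set (StableMatching I)} {f : F → ℝ} (h : IsMWSM F f) :
    MinCutRepresentable F f := by
  classical
  obtain ⟨hF, w, hw⟩ := h
  obtain ⟨c, v, hv⟩ := exists_rotation_weights (I := I) w
  refine ⟨closureCapacity F v, (∑ ρ, max (-v ρ) 0) - c, fun R => ?_, fun R hR M hM => ?_⟩
  · rw [cutValue_closureCapacity_lt_top_iff hF, isUpperClosed_and_isElimination_iff]
  · rw [toReal_cutValue_closureCapacity hF ((cutValue_closureCapacity_lt_top_iff hF R).1 hR)]
    obtain rfl := isElimination_iff.1 hM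
    have := hv M.1
    rw [pairWeight, ← hw M] at this
    rw [this]
    ring

/-! ### Meta-rotations -/

namespace ProperMeta

variable {F : Set (StableMatching I)}

theorem eq_class {θ : ProperMeta F} {σ : Rotation I} (h : σ ∈ θ.1) :
    θ.1 = {τ | MetaEquiv F σ τ} := by
  obtain ⟨ρ, hρ⟩ := θ.2.1
  rw [hρ] at h ⊢
  exact Set.ext fun τ => forall₂_congr fun M hM => by rw [h M hM]

theorem nonempty (θ : ProperMeta F) : θ.1.Nonempty := by
  obtain ⟨ρ, hρ⟩ := θ.2.1
  exact ⟨ρ, hρ ▸ fun _ _ => Iff.rfl⟩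

theorem eq_of_mem {θ θ' : ProperMeta F} {σ : Rotation I} (h : σ ∈ θ.1) (h' : σ ∈ θ'.1) : θ = θ' :=
  Subtype.ext ((eq_class h).trans (eq_class h').symm)

theorem subset_rotationsOf_iff {θ : ProperMeta F} {σ : Rotation I} (h : σ ∈ θ.1)
    {M : StableMatching I} (hM : M ∈ F) : θ.1 ⊆ rotationsOf M ↔ σ ∈ rotationsOf M := by
  refine ⟨fun hs => hs h, fun hσ τ hτ => ?_⟩
  rw [eq_class h] at hτ
  exact (hτ M hM).1 hσ

theorem exists_notMem {θ : ProperMeta F} {σ : Rotation I} (h : σ ∈ θ.1) :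
    ∃ M ∈ F, σ ∉ rotationsOf M := by
  by_contra! hc
  refine θ.2.2.1 ?_
  rw [eq_class h]
  exact Set.ext fun τ => forall₂_congr fun M hM => by simp [hc M hM]

theorem exists_mem {θ : ProperMeta F} {σ : Rotation I} (h : σ ∈ θ.1) :
    ∃ M ∈ F, σ ∈ rotationsOf M := by
  by_contra! hc
  refine θ.2.2.2 ?_
  rw [eq_class h]
  exact Set.ext fun τ => forall₂_congr fun M hM => by simp [hc M hM]

/-- A rotation that is eliminated in some but not all members of `F` lies in a proper
meta-rotation. -/
theorem exists_of_mem_of_notMem {σ : Rotation I} (h : ∃ M ∈ F, σ ∈ rotationsOf M)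
    (h' : ∃ M ∈ F, σ ∉ rotationsOf M) : ∃ θ : ProperMeta F, σ ∈ θ.1 := by
  have hmem : σ ∈ {τ | MetaEquiv F σ τ} := fun _ _ => Iff.rfl
  refine ⟨⟨{τ | MetaEquiv F σ τ}, ⟨σ, rfl⟩, fun he => ?_, fun he => ?_⟩, hmem⟩
  · rw [he] at hmem
    obtain ⟨M, hM, hn⟩ := h'
    exact hn (hmem M hM)
  · rw [he] at hmem
    obtain ⟨M, hM, hn⟩ := h
    exact hmem M hM hn

theorem metaGE_antisymm {θ θ' : ProperMeta F} (h : MetaGE θ θ') (h' : MetaGE θ' θ) : θ = θ' := by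
  obtain ⟨σ, hσ⟩ := θ.nonempty
  obtain ⟨τ, hτ⟩ := θ'.nonempty
  refine eq_of_mem hσ ?_
  rw [eq_class hτ]
  intro M hM
  rw [← subset_rotationsOf_iff hσ hM, ← subset_rotationsOf_iff hτ hM]
  exact ⟨h M hM, h' M hM⟩

end ProperMeta

open ProperMeta

/-- The union of `θ₀` and the meta-rotations in `Θ`. -/
def metaUnion {F : Set (StableMatching I)} (Θ : Set (ProperMeta F)) : Set (Rotation I) :=
  theta0 F ∪ ⋃ θ ∈ Θ, θ.1

theorem mem_metaUnion {F : Set (StableMatching I)} {Θ : Set (ProperMeta F)} {σ : Rotation I} :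
    σ ∈ metaUnion Θ ↔ σ ∈ theta0 F ∨ ∃ θ ∈ Θ, σ ∈ θ.1 := by
  simp [metaUnion]

theorem isMatchingOf_iff {F : Set (StableMatching I)} {Θ : Set (ProperMeta F)}
    {M : StableMatching I} : IsMatchingOf Θ M ↔ rotationsOf M = metaUnion Θ :=
  isElimination_iff.trans eq_comm

theorem metaUnion_metaUp {F : Set (StableMatching I)} (θ : ProperMeta F) :
    metaUnion (metaUp θ) = metaUnion (metaStrictUp θ) ∪ θ.1 := by
  ext σ
  simp only [mem_metaUnion, Set.mem_union]
  constructor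
  · rintro (h | ⟨θ', h, hσ⟩)
    · exact Or.inl (Or.inl h)
    · by_cases he : θ' = θ
      · exact Or.inr (he ▸ hσ)
      · exact Or.inl (Or.inr ⟨θ', ⟨h, he⟩, hσ⟩)
  · rintro ((h | ⟨θ', h, hσ⟩) | h)
    · exact Or.inl h
    · exact Or.inr ⟨θ', h.1, hσ⟩
    · exact Or.inr ⟨θ, fun _ _ h => h, h⟩

/-- A rotation contained in all members that contain θ is either in all members or separated by F,
and then its class is a proper meta-rotation above θ. -/
theorem metaUnion_metaUp_eq_sInf {F : Set (StableMatching I)} (θ : ProperMeta F) :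
    metaUnion (metaUp θ) = sInf {T ∈ rotationFamily F | θ.1 ⊆ T} := by
  obtain ⟨τ, hτ⟩ := θ.nonempty
  ext σ
  rw [mem_metaUnion]
  constructor
  · rintro (h | ⟨θ', h, hσ⟩)
    · rintro _ ⟨⟨M, hM, rfl⟩, -⟩
      exact h M hM
    · rintro _ ⟨⟨M, hM, rfl⟩, hθ⟩
      exact h M hM hθ hσ
  · intro h
    have h1 : ∀ M ∈ F, τ ∈ rotationsOf M → σ ∈ rotationsOf M := fun M hM hm =>
      h _ ⟨⟨M, hM, rfl⟩, (subset_rotationsOf_iff hτ hM).2 hm⟩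
    by_cases h0 : σ ∈ theta0 F
    · exact Or.inl h0
    · simp only [theta0, Set.mem_ofPred_eq, not_forall] at h0
      obtain ⟨M, hM, hn⟩ := h0
      obtain ⟨N, hN, hm⟩ := exists_mem hτ
      obtain ⟨θ', hσ⟩ := exists_of_mem_of_notMem ⟨N, hN, h1 N hN hm⟩ ⟨M, hM, hn⟩
      refine Or.inr ⟨θ', fun M hM => ?_, hσ⟩
      rw [subset_rotationsOf_iff hσ hM, subset_rotationsOf_iff hτ hM]
      exact h1 M hM

theorem metaUnion_metaUp_mem {F : Set (StableMatching I)} (hF : IsSublattice F)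
    (θ : ProperMeta F) : metaUnion (metaUp θ) ∈ rotationFamily F := by
  rw [metaUnion_metaUp_eq_sInf]
  refine hF.infClosed.sInf_mem_of_nonempty (Set.toFinite _) ?_ fun T hT => hT.1
  obtain ⟨τ, hτ⟩ := θ.nonempty
  obtain ⟨M, hM, hm⟩ := exists_mem hτ
  exact ⟨_, ⟨M, hM, rfl⟩, (subset_rotationsOf_iff hτ hM).2 hm⟩

theorem theta0_mem {F : Set (StableMatching I)} (hF : IsSublattice F) (hne : F.Nonempty) :
    theta0 F ∈ rotationFamily F := by
  have : theta0 F = sInf (rotationFamily F) := by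
    ext σ
    exact ⟨fun h T ⟨M, hM, hT⟩ => hT ▸ h M hM, fun h M hM => h _ ⟨M, hM, rfl⟩⟩
  rw [this]
  exact hF.infClosed.sInf_mem_of_nonempty (Set.toFinite _) (hne.image _) subset_rfl

theorem metaUnion_metaStrictUp_mem {F : Set (StableMatching I)} (hF : IsSublattice F)
    (θ : ProperMeta F) : metaUnion (metaStrictUp θ) ∈ rotationFamily F := by
  have hne : F.Nonempty := by
    obtain ⟨τ, hτ⟩ := θ.nonempty
    obtain ⟨M, hM, -⟩ := exists_mem hτ
    exact ⟨M, hM⟩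
  -- Inserting `theta0 F` keeps the union over a nonempty family even when nothing lies strictly
  -- above `θ`. Antisymmetry ensures that `θ` itself does not enter.
  have : metaUnion (metaStrictUp θ) =
      sSup (insert (theta0 F) ((fun θ' => metaUnion (metaUp θ')) '' metaStrictUp θ)) := by
    ext σ
    simp only [Set.sSup_eq_sUnion, Set.sUnion_insert, Set.sUnion_image, Set.mem_union,
      Set.mem_iUnion, exists_prop]
    rw [mem_metaUnion]
    refine or_congr_right' fun h0 => ?_
    constructor
    · rintro ⟨θ', h, hσ⟩
      exact ⟨θ', h, mem_metaUnion.2 (Or.inr ⟨θ', fun _ _ h => h, hσ⟩)⟩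
    · rintro ⟨θ', h, hσ⟩
      obtain ⟨θ'', h2, hσ⟩ := (mem_metaUnion.1 hσ).resolve_left h0
      refine ⟨θ'', ⟨fun M hM hs => h2 M hM (h.1 M hM hs), ?_⟩, hσ⟩
      rintro rfl
      exact h.2 (metaGE_antisymm h.1 h2)
  rw [this]
  refine hF.supClosed.sSup_mem_of_nonempty (Set.toFinite _) (Set.insert_nonempty _ _) ?_
  refine Set.insert_subset (theta0_mem hF hne) ?_
  rintro _ ⟨θ', -, rfl⟩
  exact metaUnion_metaUp_mem hF θ'

theorem IsMWSM.hasSecondDifferential {F : Set (StableMatching I)} {f : F → ℝ} (h : IsMWSM F f)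
    {θ θ' : ProperMeta F} (hne : θ ≠ θ') : HasSecondDifferential f θ θ' 0 := by
  classical
  obtain ⟨hF, w, hw⟩ := h
  obtain ⟨c, v, hv⟩ := exists_rotation_weights (I := I) w
  obtain ⟨Mu, hMu, eu⟩ := metaUnion_metaUp_mem hF θ
  obtain ⟨Ml, hMl, el⟩ := metaUnion_metaStrictUp_mem hF θ
  obtain ⟨Mu', hMu', eu'⟩ := metaUnion_metaUp_mem hF θ'
  obtain ⟨Ml', hMl', el'⟩ := metaUnion_metaStrictUp_mem hF θ'
  obtain ⟨-, P, hP, gP⟩ := hF Mu hMu Ml' hMl'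
  obtain ⟨-, Q, hQ, gQ⟩ := hF Ml hMl Mu' hMu'
  obtain ⟨-, R, hR, gR⟩ := hF Ml hMl Ml' hMl'
  obtain ⟨-, S, hS, gS⟩ := hF Mu hMu Mu' hMu'
  refine ⟨Mu, Ml, Mu', Ml', isMatchingOf_iff.2 eu, isMatchingOf_iff.2 el, isMatchingOf_iff.2 eu',
    isMatchingOf_iff.2 el', ⟨P, hP⟩, ⟨Q, hQ⟩, ⟨R, hR⟩, ⟨S, hS⟩, gP, gQ, gR, gS, ?_⟩
  have hf : ∀ M : F, f M = c + ∑ ρ, if ρ ∈ rotationsOf M.1 then v ρ else 0 := fun M =>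
    (hw M).trans (hv M.1)
  -- Each rotation occurs equally often on both sides, because `θ` and `θ'` are disjoint.
  have key : (∑ ρ, if ρ ∈ rotationsOf P then v ρ else 0) +
      (∑ ρ, if ρ ∈ rotationsOf Q then v ρ else 0) =
      (∑ ρ, if ρ ∈ rotationsOf R then v ρ else 0) +
      ∑ ρ, if ρ ∈ rotationsOf S then v ρ else 0 := by
    rw [← Finset.sum_add_distrib, ← Finset.sum_add_distrib]
    refine Finset.sum_congr rfl fun ρ _ => ?_
    rw [rotationsOf_min (isGLB_iff_rank.1 gP), rotationsOf_min (isGLB_iff_rank.1 gQ),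
      rotationsOf_min (isGLB_iff_rank.1 gR), rotationsOf_min (isGLB_iff_rank.1 gS), eu, el, eu',
      el', metaUnion_metaUp, metaUnion_metaUp]
    have hdisj : ρ ∈ θ.1 → ρ ∉ θ'.1 := fun h1 h2 => hne (eq_of_mem h1 h2)
    simp only [Set.mem_union]
    by_cases h1 : ρ ∈ θ.1 <;> by_cases h2 : ρ ∈ θ'.1 <;>
      by_cases h3 : ρ ∈ metaUnion (metaStrictUp θ) <;>
      by_cases h4 : ρ ∈ metaUnion (metaStrictUp θ') <;> simp_all
  rw [hf, hf, hf, hf]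
  linarith

/-! ### Minimum cut representations with vanishing second order differentials -/

/-- A cut is finite when no infinite arc leaves it, a property preserved by unions and
intersections. -/
theorem MinCutRepresentable.isSublattice {F : Set (StableMatching I)} {f : F → ℝ}
    (h : MinCutRepresentable F f) : IsSublattice F := by
  obtain ⟨u, C, hu, -⟩ := h
  simp only [isUpperClosed_and_isElimination_iff] at hu
  apply isSublattice_of_closed
  · intro P hP Q hQ
    rw [← hu, cutValue_lt_top_iff] at hP hQ ⊢
    intro v w hv hw
    change v ∈ cutSide (P ∪ Q) at hv
    change w ∉ cutSide (P ∪ Q) at hw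
    rw [mem_cutSide_union] at hv hw
    push Not at hw
    exact hv.elim (fun h => hP v w h hw.1) fun h => hQ v w h hw.2
  · intro P hP Q hQ
    rw [← hu, cutValue_lt_top_iff] at hP hQ ⊢
    intro v w hv hw
    change v ∈ cutSide (P ∩ Q) at hv
    change w ∉ cutSide (P ∩ Q) at hw
    rw [mem_cutSide_inter] at hv hw
    by_cases hwP : w ∈ cutSide P
    · exact hQ v w hv.2 fun hwQ => hw ⟨hwP, hwQ⟩
    · exact hP v w hv.1 hwP

open Classical in
/-- Equality in the submodularity of a cut function excludes arcs between the two differences. -/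
theorem capacity_eq_zero_of_modular {c : Vertex I → Vertex I → ℝ} (hc : ∀ v w, 0 ≤ c v w)
    {g : Set (Rotation I) → ℝ} (hg : ∀ R, g R =
      ∑ v : Vertex I, ∑ w : Vertex I, if v ∈ cutSide R ∧ w ∉ cutSide R then c v w else 0)
    {P Q : Set (Rotation I)} (h : g P + g Q = g (P ∩ Q) + g (P ∪ Q)) {ρ σ : Rotation I}
    (hρP : ρ ∈ P) (hρQ : ρ ∉ Q) (hσP : σ ∉ P) (hσQ : σ ∈ Q) : c (Sum.inl ρ) (Sum.inl σ) = 0 := by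
  let t : Set (Rotation I) → Vertex I → Vertex I → ℝ := fun R v w =>
    if v ∈ cutSide R ∧ w ∉ cutSide R then c v w else 0
  -- The submodularity defect of a single arc. Defects are nonnegative with sum zero, hence all
  -- vanish, and the defect of the arc from `ρ` to `σ` is its capacity.
  let D : Vertex I → Vertex I → ℝ := fun v w => t P v w + t Q v w - t (P ∩ Q) v w - t (P ∪ Q) v w
  have hD : ∀ v w, 0 ≤ D v w := by
    intro v w
    have := hc v w
    simp only [D, t, mem_cutSide_union, mem_cutSide_inter]
    by_cases h1 : v ∈ cutSide P <;> by_cases h2 : v ∈ cutSide Q <;>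
      by_cases h3 : w ∈ cutSide P <;> by_cases h4 : w ∈ cutSide Q <;> simp [h1, h2, h3, h4, this]
  have hsum : ∑ v, ∑ w, D v w = 0 := by
    simp only [D, Finset.sum_add_distrib, Finset.sum_sub_distrib, t, ← hg]
    linarith
  have h1 := (Finset.sum_eq_zero_iff_of_nonneg fun v _ =>
    Finset.sum_nonneg fun w _ => hD v w).1 hsum (Sum.inl ρ) (Finset.mem_univ _)
  have h2 := (Finset.sum_eq_zero_iff_of_nonneg fun w _ => hD _ w).1 h1 (Sum.inl σ)
    (Finset.mem_univ _)
  simpa [D, t, hρP, hρQ, hσP, hσQ] using h2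

/-- Two proper meta-rotations that are incomparable and have vanishing second order differential
are not joined by an arc. -/
theorem capacity_eq_zero_of_incomparable {F : Set (StableMatching I)} {f : F → ℝ}
    {u : Vertex I → Vertex I → ENNReal} {C : ℝ}
    (hu : ∀ R, cutValue u R < ⊤ ↔ R ∈ rotationFamily F)
    (hf : ∀ M : F, (cutValue u (rotationsOf M.1)).toReal = f M + C)
    (hd : ∀ θ θ' : ProperMeta F, θ ≠ θ' → HasSecondDifferential f θ θ' 0) {ρ σ : Rotation I}
    (h₁ : ∃ M ∈ F, ρ ∈ rotationsOf M ∧ σ ∉ rotationsOf M)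
    (h₂ : ∃ M ∈ F, σ ∈ rotationsOf M ∧ ρ ∉ rotationsOf M) :
    (u (Sum.inl ρ) (Sum.inl σ)).toReal = 0 := by
  classical
  obtain ⟨M₁, hM₁, hρ₁, hσ₁⟩ := h₁
  obtain ⟨M₂, hM₂, hσ₂, hρ₂⟩ := h₂
  obtain ⟨θ, hρ⟩ := exists_of_mem_of_notMem ⟨M₁, hM₁, hρ₁⟩ ⟨M₂, hM₂, hρ₂⟩
  obtain ⟨θ', hσ⟩ := exists_of_mem_of_notMem ⟨M₂, hM₂, hσ₂⟩ ⟨M₁, hM₁, hσ₁⟩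
  have hge : ¬ MetaGE θ θ' := fun h => hρ₂ (h M₂ hM₂ ((subset_rotationsOf_iff hσ hM₂).2 hσ₂) hρ)
  have hge' : ¬ MetaGE θ' θ := fun h => hσ₁ (h M₁ hM₁ ((subset_rotationsOf_iff hρ hM₁).2 hρ₁) hσ)
  have hne : θ ≠ θ' := by
    rintro rfl
    exact hge fun _ _ h => h
  obtain ⟨Mu, Ml, Mu', Ml', eu, el, eu', el', P, Q, R, S, gP, gQ, gR, gS, hPQ⟩ := hd θ θ' hne
  rw [isMatchingOf_iff] at eu el eu' el'
  have rP := rotationsOf_min (isGLB_iff_rank.1 gP)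
  have rQ := rotationsOf_min (isGLB_iff_rank.1 gQ)
  have rR := rotationsOf_min (isGLB_iff_rank.1 gR)
  have rS := rotationsOf_min (isGLB_iff_rank.1 gS)
  rw [metaUnion_metaUp, ← el] at eu
  rw [metaUnion_metaUp, ← el'] at eu'
  -- With this and `hS`, the vanishing differential becomes equality in the submodular inequality
  -- for the rotation sets of `P` and `Q`.
  have hR : rotationsOf R.1 = rotationsOf P.1 ∩ rotationsOf Q.1 := by
    rw [rP, rQ, rR, eu, eu']
    ext τ
    have : τ ∈ θ.1 → τ ∉ θ'.1 := fun h1 h2 => hne (eq_of_mem h1 h2)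
    simp only [Set.mem_union, Set.mem_inter_iff]
    tauto
  have hS : rotationsOf S.1 = rotationsOf P.1 ∪ rotationsOf Q.1 := by
    rw [rP, rQ, rS, eu, eu']
    ext τ
    simp only [Set.mem_union]
    tauto
  -- Incomparability enters here: it puts `ρ` only on the side of `P` and `σ` only on the side of
  -- `Q`.
  have notMem : ∀ {θ θ' : ProperMeta F} {τ : Rotation I}, τ ∈ θ.1 → (¬ MetaGE θ θ' ∨ θ = θ') →
      τ ∉ metaUnion (metaStrictUp θ') := by
    intro θ θ' τ hτ hθ hm
    rcases mem_metaUnion.1 hm with h | ⟨θ'', h, hτ'⟩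
    · obtain ⟨M, hM, hn⟩ := exists_notMem hτ
      exact hn (h M hM)
    · obtain rfl := eq_of_mem hτ hτ'
      exact hθ.elim (fun hθ => hθ h.1) h.2
  refine capacity_eq_zero_of_modular (c := fun v w => (u v w).toReal)
    (fun _ _ => ENNReal.toReal_nonneg) (fun _ => rfl) (P := rotationsOf P.1)
    (Q := rotationsOf Q.1) ?_ ?_ ?_ ?_ ?_
  · have hcut : ∀ M : F, _ := fun M : F => toReal_cutValue ((hu _).2 ⟨M.1, M.2, rfl⟩)
    rw [← hR, ← hS, ← hcut, ← hcut, ← hcut, ← hcut, hf, hf, hf, hf]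
    linarith
  · rw [rP, eu]
    exact Or.inl (Or.inr hρ)
  · rw [rQ, eu', el, el']
    rintro (h | h | h)
    · exact notMem hρ (Or.inr rfl) h
    · exact notMem hρ (Or.inl hge) h
    · exact hne (eq_of_mem hρ h)
  · rw [rP, eu, el, el']
    rintro ((h | h) | h)
    · exact notMem hσ (Or.inl hge') h
    · exact hne (eq_of_mem h hσ)
    · exact notMem hσ (Or.inr rfl) h
  · rw [rQ, eu']
    exact Or.inr (Or.inr hσ)

/-! ### Linear objectives -/

open Classical in
theorem pairWeight_single (M : StableMatching I) (a : A) (g : B → ℝ) {b : B}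
    (hb : M.toMatching.partner a = some b) :
    pairWeight (fun a' b' => if a' = a then g b' else 0) M = g b := by
  unfold pairWeight
  rw [Finset.sum_eq_single a]
  · rw [Finset.sum_eq_single b] <;> simp +contextual [hb, eq_comm]
  · intro a' _ hne
    simp [hne]
  · simp

/-- The objectives on `F` that are linear in the matched pairs. -/
def linearObjectives (F : Set (StableMatching I)) : Submodule ℝ (F → ℝ) where
  carrier := {f | IsLinearObjective F f}
  zero_mem' := ⟨0, fun M => by simp⟩
  add_mem' := by
    rintro f g ⟨w, hw⟩ ⟨w', hw'⟩
    refine ⟨w + w', fun M => ?_⟩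
    rw [Pi.add_apply, hw, hw', ← Finset.sum_add_distrib]
    refine Finset.sum_congr rfl fun a _ => ?_
    rw [← Finset.sum_add_distrib]
    refine Finset.sum_congr rfl fun b _ => ?_
    split_ifs <;> simp
  smul_mem' := by
    rintro r f ⟨w, hw⟩
    refine ⟨r • w, fun M => ?_⟩
    rw [Pi.smul_apply, hw, smul_eq_mul, Finset.mul_sum]
    refine Finset.sum_congr rfl fun a _ => ?_
    rw [Finset.mul_sum]
    refine Finset.sum_congr rfl fun b _ => ?_
    split_ifs <;> simp

theorem const_mem_linearObjectives {M₁ : StableMatching I} {a : A} {b : B}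
    (h : M₁.toMatching.partner a = some b) (F : Set (StableMatching I)) (r : ℝ) :
    (fun _ => r) ∈ linearObjectives F := by
  classical
  -- The student `a` is matched in every stable matching, so exactly one pair of weight `r` is
  -- counted.
  refine ⟨fun a' _ => if a' = a then r else 0, fun M => ?_⟩
  have hM : M.1.toMatching.partner a ≠ none := fun hn => by
    simp [(partner_eq_none_iff M.1 M₁ a).1 hn] at h
  obtain ⟨b', hb'⟩ := Option.ne_none_iff_exists'.1 hM
  exact (pairWeight_single M.1 a (fun _ => r) hb').symm

-- The student from `exists_rank_threshold` is always matched, so weight one on its pairs at or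
-- below the threshold detects the rotation.
open Classical in
theorem indicator_mem_linearObjectives (F : Set (StableMatching I)) (ρ : Rotation I) :
    (fun M : F => if ρ ∈ rotationsOf M.1 then (1 : ℝ) else 0) ∈ linearObjectives F := by
  obtain ⟨a, c, hc, ha⟩ := exists_rank_threshold ρ
  refine ⟨fun a' b' => if a' = a then (if stuRank I a (some b') ≤ c then 1 else 0) else 0,
    fun M => ?_⟩
  obtain ⟨b, hb⟩ := Option.ne_none_iff_exists'.1 (ha M.1)
  refine Eq.trans ?_ (pairWeight_single M.1 a (fun b' => if stuRank I a (some b') ≤ c then 1 else 0)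
    hb).symm
  simp only [hc, rank, hb]

theorem MinCutRepresentable.isLinearObjective {F : Set (StableMatching I)} {f : F → ℝ}
    (hpair : ∃ (M : StableMatching I) (a : A) (b : B), M.toMatching.partner a = some b)
    (h : MinCutRepresentable F f)
    (hd : ∀ θ θ' : ProperMeta F, θ ≠ θ' → HasSecondDifferential f θ θ' 0) :
    IsLinearObjective F f := by
  classical
  obtain ⟨M₁, a, b, hab⟩ := hpair
  have hconst := const_mem_linearObjectives hab F
  obtain ⟨u, C, hu, hf⟩ := h
  simp only [isUpperClosed_and_isElimination_iff] at hu
  have hf' : ∀ M : F, (cutValue u (rotationsOf M.1)).toReal = f M + C := fun M =>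
    hf _ ((hu _).2 ⟨M.1, M.2, rfl⟩) M (isElimination_iff.2 rfl)
  have hfe : f = (∑ v : Vertex I, ∑ w : Vertex I, fun M : F =>
      if v ∈ cutSide (rotationsOf M.1) ∧ w ∉ cutSide (rotationsOf M.1) then (u v w).toReal else 0)
      + fun _ => -C := by
    funext M
    have := hf' M
    rw [toReal_cutValue ((hu _).2 ⟨M.1, M.2, rfl⟩)] at this
    simp only [Pi.add_apply, Finset.sum_apply, this]
    ring
  change f ∈ linearObjectives F
  rw [hfe]
  refine add_mem (sum_mem fun v _ => sum_mem fun w _ => ?_) (hconst _)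
  have hind := fun (ρ : Rotation I) (r : ℝ) =>
    (linearObjectives F).smul_mem r (indicator_mem_linearObjectives F ρ)
  rcases v with ρ | x
  · rcases w with σ | y
    · simp only [inl_mem_cutSide]
      -- If `h₁` fails, no member of `F` cuts the arc. If only `h₂` fails, `σ` forces `ρ` and the
      -- arc contributes a multiple of the difference of the two indicators. If both hold, its
      -- capacity has real value zero.
      by_cases h₁ : ∃ M ∈ F, ρ ∈ rotationsOf M ∧ σ ∉ rotationsOf M
      · by_cases h₂ : ∃ M ∈ F, σ ∈ rotationsOf M ∧ ρ ∉ rotationsOf M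
        · rw [capacity_eq_zero_of_incomparable hu hf' hd h₁ h₂]
          simpa using hconst 0
        · push Not at h₂
          convert sub_mem (hind ρ (u (Sum.inl ρ) (Sum.inl σ)).toReal)
            (hind σ (u (Sum.inl ρ) (Sum.inl σ)).toReal) using 1
          funext M
          have := h₂ M.1 M.2
          by_cases h3 : σ ∈ rotationsOf M.1
          · simp [h3, this h3]
          · by_cases h4 : ρ ∈ rotationsOf M.1 <;> simp [h3, h4]
      · push Not at h₁
        convert hconst 0 using 1
        funext M
        exact if_neg fun h3 => h3.2 (h₁ M.1 M.2 h3.1)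
    · cases y
      · simpa using hconst 0
      · convert hind ρ (u (Sum.inl ρ) (Sum.inr true)).toReal using 1
        funext M
        simp
  · cases x
    · rcases w with σ | y
      · convert sub_mem (hconst (u (Sum.inr false) (Sum.inl σ)).toReal)
          (hind σ (u (Sum.inr false) (Sum.inl σ)).toReal) using 1
        funext M
        by_cases h3 : σ ∈ rotationsOf M.1 <;> simp [h3]
      · cases y
        · simpa using hconst 0
        · simpa using hconst _
    · simpa using hconst 0

end StableMatchingOpt

theorem theorem4 {A B : Type*} [Fintype A] [Fintype B]
    (I : StableMatchingOpt.SchoolInstance A B)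
    (hpair : ∃ (M : StableMatchingOpt.StableMatching I) (a : A) (b : B),
      M.toMatching.partner a = some b)
    (F : Set (StableMatchingOpt.StableMatching I)) (f : F → ℝ) :
    StableMatchingOpt.IsMWSM F f ↔
      StableMatchingOpt.MinCutRepresentable F f ∧
        ∀ θ θ' : StableMatchingOpt.ProperMeta F, θ ≠ θ' →
          StableMatchingOpt.HasSecondDifferential f θ θ' 0 :=
  ⟨fun h => ⟨h.minCutRepresentable, fun _ _ hne => h.hasSecondDifferential hne⟩,
    fun ⟨h, hd⟩ => ⟨h.isSublattice, h.isLinearObjective hpair hd⟩⟩
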